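/- Let $R=\mathbb C[x,y,z]$ and $S=\mathbb C[x,y,z,w]$. For a polynomial $h$ in $n$ variables $x_1,\dots,x_n$ over $\mathbb C$ let $D_0(h)$ be the graded module of tuples $(\delta_1,\dots,\delta_n)$ of polynomials with $\sum_i\delta_i\,\partial h/\partial x_i=0$, and let $\mathrm{mdr}(h)$ be the least degree of a nonzero homogeneous element of $D_0(h)$. The following terms are used. * The hypersurface $h=0$ is *free* if $D_0(h)$ is a free module. * It is *nearly free* if $D_0(h)$ has a minimal graded free resolution $0\to P(-d_n-1)\to\bigoplus_{i=1}^{n}P(-d_i)\to D_0(h)\to 0$ with $d_1\le\dots\le d_{n-1}=d_n$, where $P$ is the polynomial ring. * It is *plus-one generated with respect to* $(\sigma_1,\dots,\sigma_n)$ if $D_0(h)$ has a minimal graded free resolution $0\to P(-d_n-1)\to\bigoplus_{i=1}^{n}P(-d_i)\to D_0(h)\to 0$ in which the $i$-th basis vector is sent to $\sigma_i$. It is *strictly* so if in addition the coefficient of $\sigma_n$ in the generating relation $\sum_i a_i\sigma_i=0$ is nonzero. * A surface $h=0$ in $\mathbb P^3$ is *tame with respect to* $(\sigma,\sigma')$,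 where $\sigma,\sigma'\in D_0(h)$, if $\sigma,\sigma'$ are linearly independent over $S$ and generate the kernel of the map $D_0(h)\to S$, $\delta\mapsto\det(E,\sigma,\sigma',\delta)$, where $E=(x,y,z,w)$. **Theorem.** Let $C:g=0$ be a reduced curve in $\mathbb P^2$, with $g\in R$ homogeneous of degree $e=d-1$ and $\mathrm{mdr}(g)>0$. Let $f=wg\in S$, and let $cC:f=0$ be the cone over $C$, a surface of degree $d$ in $\mathbb P^3$. Put $\rho_0=(x,y,z,-(d-1)w)$, and for $r_j=(r_{j1},r_{j2},r_{j3})\in R^3$ put $\rho_j=(r_{j1},r_{j2},r_{j3},0)$. 1. If $r_1,\dots,r_m$ is a minimal set of homogeneous generators of the $R$-module $D_0(g)$, then $\rho_0,\rho_1,\dots,\rho_m$ is a minimal set of homogeneous generators of the $S$-module $D_0(f)$. In particular $\mathrm{mdr}(f)=1$. Moreover, if $$0\to\bigoplus_{j=1}^{q}R(-c_j)\to\bigoplus_{i=1}^{p}R(-d_i)\to D_0(g)\to 0$$ is a minimal graded free resolution, in which the $i$-th basis vector is sent to $r_i$, then $D_0(f)$ has the minimal graded free resolution $$0\to\bigoplus_{j=1}^{q}S(-c_j)\to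 S(-1)\oplus\bigoplus_{i=1}^{p}S(-d_i)\to D_0(f)\to 0$$ in which the basis vectors of the middle term are sent to $\rho_0,\rho_1,\dots,\rho_p$, and the first map is that of the resolution of $D_0(g)$, with zero component in $S(-1)$. 2. If $r_1,\dots,r_m$ is a minimal set of homogeneous generators of $D_0(g)$, then the surface $cC$ is tame with respect to $(\rho_0,\rho_1)$ (and likewise with respect to $(\rho_0,\rho_j)$ for every $j\ge 1$, the numbering being arbitrary). 3. The surface $cC$ is free if and only if $C$ is free, and it is nearly free if and only if $C$ is nearly free. For all $r_1,r_2,r_3\in R^3$, the surface $cC$ is strictly plus-one generated with respect to $(\rho_0,\rho_1,\rho_2,\rho_3)$ if and only if $C$ is plus-one generated with respect to $(r_1,r_2,r_3)$. -/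

import Mathlib

open MvPolynomial

noncomputable section

namespace JacobianSyzygies

/-- The module `D₀(f)` of derivations `∑ i, δ i ∂/∂x_i` with polynomial coefficients that kill `f`,
a derivation being identified with its tuple of coefficients. -/
def D0 {n : ℕ} (f : MvPolynomial (Fin n) ℂ) :
    Submodule (MvPolynomial (Fin n) ℂ) (Fin n → MvPolynomial (Fin n) ℂ) where
  carrier := {δ | ∑ i, δ i * pderiv i f = 0}
  zero_mem' := by simp
  add_mem' := by
    intro a b ha hb
    simp only [Set.mem_ofPred_eq] at ha hb ⊢
    simp [add_mul, Finset.sum_add_distrib, ha, hb]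
  smul_mem' := by
    intro c a ha
    simp only [Set.mem_ofPred_eq] at ha ⊢
    simp [mul_assoc, ← Finset.mul_sum, ha]

/-- All coefficients of the derivation `δ` are homogeneous of degree `k`. -/
def IsHomogeneousOfDegree {n : ℕ} (δ : Fin n → MvPolynomial (Fin n) ℂ) (k : ℕ) : Prop :=
  ∀ i, (δ i).IsHomogeneous k

/-- The minimal degree of a nonzero homogeneous element of `D₀(f)`. -/
def mdr {n : ℕ} (f : MvPolynomial (Fin n) ℂ) : ℕ :=
  sInf {k | ∃ δ ∈ D0 f, δ ≠ 0 ∧ IsHomogeneousOfDegree δ k}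

/-- The family `r` is a minimal (that is, irredundant) family of homogeneous generators of `M`. -/
structure IsMinimalGenerators {n m : ℕ}
    (M : Submodule (MvPolynomial (Fin n) ℂ) (Fin n → MvPolynomial (Fin n) ℂ))
    (r : Fin m → Fin n → MvPolynomial (Fin n) ℂ) : Prop where
  homogeneous : ∀ j, ∃ k, IsHomogeneousOfDegree (r j) k
  span_eq : Submodule.span (MvPolynomial (Fin n) ℂ) (Set.range r) = M
  irredundant : ∀ j, r j ∉ Submodule.span (MvPolynomial (Fin n) ℂ) (r '' {j}ᶜ)

/-- The families `r` and `A` form a minimal graded free resolution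
`0 ⟶ ⨁ j, S(-c j) ⟶ ⨁ i, S(-d i) ⟶ M ⟶ 0` of the graded module `M`. The second map sends the `i`-th
basis vector to the generator `r i`, of degree `d i`. The first one sends the `j`-th basis vector to
the relation `A j` between the generators, whose `i`-th entry has degree `c j - d i`. -/
structure IsMinimalResolution {n p q : ℕ}
    (M : Submodule (MvPolynomial (Fin n) ℂ) (Fin n → MvPolynomial (Fin n) ℂ))
    (d : Fin p → ℕ) (c : Fin q → ℕ)
    (r : Fin p → Fin n → MvPolynomial (Fin n) ℂ)
    (A : Fin q → Fin p → MvPolynomial (Fin n) ℂ) : Prop where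
  /-- The map `⨁ i, S(-d i) ⟶ M` is graded of degree zero. -/
  homogeneous_gen : ∀ i, IsHomogeneousOfDegree (r i) (d i)
  /-- The map `⨁ j, S(-c j) ⟶ ⨁ i, S(-d i)` is graded of degree zero. -/
  homogeneous_rel : ∀ j i, A j i = 0 ∨ ∃ k, k + d i = c j ∧ (A j i).IsHomogeneous k
  /-- Exactness at `M`. -/
  span_eq : Submodule.span (MvPolynomial (Fin n) ℂ) (Set.range r) = M
  /-- Exactness at `⨁ i, S(-d i)`. -/
  exact_rel : ∀ h : Fin p → MvPolynomial (Fin n) ℂ,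
    ∑ i, h i • r i = 0 ↔ h ∈ Submodule.span (MvPolynomial (Fin n) ℂ) (Set.range A)
  /-- Exactness at `⨁ j, S(-c j)`. -/
  injective_rel : LinearIndependent (MvPolynomial (Fin n) ℂ) A
  /-- Minimality: the entries of the first map lie in the irrelevant maximal ideal. -/
  minimal : ∀ j i, constantCoeff (A j i) = 0

/-- The hypersurface `f = 0` is free. -/
def IsFree {n : ℕ} (f : MvPolynomial (Fin n) ℂ) : Prop :=
  Module.Free (MvPolynomial (Fin n) ℂ) (D0 f)

/-- The hypersurface `f = 0` in projective space of dimension `n + 1` is nearly free: `D₀(f)` has a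
minimal resolution `0 ⟶ S(-d_{n+1} - 1) ⟶ S(-d_0) ⊕ ⋯ ⊕ S(-d_{n+1}) ⟶ D₀(f) ⟶ 0` with
`d_0 ≤ ⋯ ≤ d_n = d_{n+1}`. -/
def IsNearlyFree {n : ℕ} (f : MvPolynomial (Fin (n + 2)) ℂ) : Prop :=
  ∃ (d : Fin (n + 2) → ℕ) (ρ : Fin (n + 2) → Fin (n + 2) → MvPolynomial (Fin (n + 2)) ℂ)
    (a : Fin (n + 2) → MvPolynomial (Fin (n + 2)) ℂ),
    Monotone d ∧ d (Fin.last n).castSucc = d (Fin.last (n + 1)) ∧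
    IsMinimalResolution (D0 f) d ![d (Fin.last (n + 1)) + 1] ρ ![a]

/-- The hypersurface `f = 0` in projective `n`-space is plus-one generated with respect to
`ρ = (ρ_0, …, ρ_n)`: these are minimal generators of `D₀(f)`, of degrees `d_0, …, d_n`, and their
relations form a free module on one relation `∑ i, a_i ρ_i = 0`, of degree `d_n + 1`. -/
def IsPlusOneGenerated {n : ℕ} (f : MvPolynomial (Fin (n + 1)) ℂ)
    (ρ : Fin (n + 1) → Fin (n + 1) → MvPolynomial (Fin (n + 1)) ℂ) : Prop :=
  ∃ (d : Fin (n + 1) → ℕ) (a : Fin (n + 1) → MvPolynomial (Fin (n + 1)) ℂ),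
    IsMinimalResolution (D0 f) d ![d (Fin.last n) + 1] ρ ![a]

/-- Strictly plus-one generated: moreover the coefficient `a_n` (a linear form) of the last
generator in the relation is nonzero. -/
def IsStrictlyPlusOneGenerated {n : ℕ} (f : MvPolynomial (Fin (n + 1)) ℂ)
    (ρ : Fin (n + 1) → Fin (n + 1) → MvPolynomial (Fin (n + 1)) ℂ) : Prop :=
  ∃ (d : Fin (n + 1) → ℕ) (a : Fin (n + 1) → MvPolynomial (Fin (n + 1)) ℂ),
    IsMinimalResolution (D0 f) d ![d (Fin.last n) + 1] ρ ![a] ∧ a (Fin.last n) ≠ 0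

/-- The surface `f = 0` in projective 3-space is tame with respect to the pair `(ρ, σ)` of elements
of `D₀(f)`: the Bourbaki sequence `0 ⟶ S ρ ⊕ S σ ⟶ D₀(f) ⟶ S` is exact, where the last map sends
`δ` to the determinant with rows the Euler field, `ρ`, `σ` and `δ`. (This determinant is a multiple
of `f`, and the map is usually divided by `f`, which does not change its kernel.) -/
structure IsTame (f : MvPolynomial (Fin 4) ℂ) (ρ σ : Fin 4 → MvPolynomial (Fin 4) ℂ) : Prop where
  left_mem : ρ ∈ D0 f
  right_mem : σ ∈ D0 f
  linearIndependent : LinearIndependent (MvPolynomial (Fin 4) ℂ) ![ρ, σ]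
  exact : ∀ δ ∈ D0 f, (Matrix.of ![fun i => X i, ρ, σ, δ]).det = 0 →
    δ ∈ Submodule.span (MvPolynomial (Fin 4) ℂ) {ρ, σ}

/-- A polynomial in `x, y, z` seen as a polynomial in `x, y, z, w`. -/
def lift (p : MvPolynomial (Fin 3) ℂ) : MvPolynomial (Fin 4) ℂ :=
  rename Fin.castSucc p

/-- The equation `f = w g` of the cone over the plane curve `g = 0`. -/
def cone (g : MvPolynomial (Fin 3) ℂ) : MvPolynomial (Fin 4) ℂ :=
  X 3 * lift g

/-- The derivation `ρ_0 = (x, y, z, -e w)`, where `e` is the degree of the curve. -/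
def coneEuler (e : ℕ) : Fin 4 → MvPolynomial (Fin 4) ℂ :=
  ![X 0, X 1, X 2, -(e : MvPolynomial (Fin 4) ℂ) * X 3]

/-- The derivation `(a, b, c, 0)` attached to `r = (a, b, c)`. -/
def extend (r : Fin 3 → MvPolynomial (Fin 3) ℂ) : Fin 4 → MvPolynomial (Fin 4) ℂ :=
  ![lift (r 0), lift (r 1), lift (r 2), 0]

/-- The family `(ρ_0, ρ_1, …, ρ_m)` attached to `(r_1, …, r_m)`. -/
def coneFamily {m : ℕ} (e : ℕ) (r : Fin m → Fin 3 → MvPolynomial (Fin 3) ℂ) :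
    Fin (m + 1) → Fin 4 → MvPolynomial (Fin 4) ℂ :=
  Fin.cons (coneEuler e) fun j => extend (r j)

end JacobianSyzygies

end

/-!
Over `S = R[w]` the module `D₀` of the cone `w g = 0` splits. If `δ` kills `w g`, then `w` divides
the last entry of `δ`, because `g` does not involve `w`; subtracting a multiple of
`ρ₀ = (x, y, z, -e w)`, which is possible because `e ≠ 0`, makes this entry vanish, and what is left
is a derivation in `x, y, z` over `S` that kills `g`. As `S` is free over `R` on the powers of `w`,
solutions over `S` of linear systems over `R` are generated by solutions over `R`. Hence
`D₀(w g) = S ρ₀ ⊕ S ⊗ D₀(g)`, and generators, relations and resolutions extend from `g` to the cone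
(`exists_eq_smul_coneEuler_add`, `mem_span_liftVec_of_forall`, `IsMinimalResolution.coneFamily`).
A resolution of the cone on generators `ρ₀, ρ₁, …` coming from the curve restricts to `w = 0`
(`IsMinimalResolution.of_coneFamily`).

Tameness: a minimal generator `r` of `D₀(g)` has coprime entries
(`IsMinimalGenerators.exists_eq_smul`), since dividing it by a common factor gives another element
of `D₀(g)`. If `det (E, ρ₀, ρ, δ) = 0`, then the `x, y, z`-part of `δ` and `r` are both orthogonal
to the gradient of `g` and coplanar with the Euler vector, so they are parallel, and the first is
a multiple of the second. The same property shows that the last coefficient of the relation of a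
plus-one generated plane curve cannot vanish.

The converses for freeness and near freeness use that minimal generators and resolutions of a
graded module are unique up to a graded change of basis. The key is the graded Nakayama lemma in
the form `isMinimalGenerators_iff`: homogeneous generators are minimal if and only if no relation
between them has a coefficient with nonzero constant term. It makes the transition matrices between
two minimal families inverse to each other modulo the irrelevant ideal. Therefore the degrees agree
(`IsMinimalGenerators.exists_equiv`), a resolution can be transported to any other minimal
generators (`IsMinimalResolution.exists_of_isMinimalGenerators`), and minimal generators of a free
module form a basis (`IsMinimalGenerators.linearIndependent_of_free`).
-/

noncomputable section

namespace JacobianSyzygies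

/-! ### Homogeneous components with integer degrees -/

section Graded

variable {n : ℕ}

/-- The standard grading, with degrees in `ℤ` so that shifts by differences of degrees need no
truncated subtraction. -/
abbrev unitWeight {n : ℕ} : Fin n → ℤ := fun _ => 1

/-- `p` is homogeneous of degree `z`; for `z < 0` this means `p = 0`. -/
abbrev HomInt (p : MvPolynomial (Fin n) ℂ) (z : ℤ) : Prop :=
  IsWeightedHomogeneous unitWeight p z

/-- The homogeneous component of degree `z`; it vanishes for `z < 0`. -/
abbrev compInt (z : ℤ) : MvPolynomial (Fin n) ℂ →ₗ[ℂ] MvPolynomial (Fin n) ℂ :=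
  weightedHomogeneousComponent unitWeight z

lemma weight_unitWeight (m : Fin n →₀ ℕ) :
    Finsupp.weight (unitWeight : Fin n → ℤ) m = (Finsupp.weight 1 m : ℕ) := by
  simp [Finsupp.weight_apply, Finsupp.sum]

lemma homInt_of_isHomogeneous {p : MvPolynomial (Fin n) ℂ} {k : ℕ} (hp : p.IsHomogeneous k) :
    HomInt p k := by
  intro m hm
  rw [weight_unitWeight, hp hm]

lemma homInt_natCast_iff {p : MvPolynomial (Fin n) ℂ} {k : ℕ} :
    HomInt p k ↔ p.IsHomogeneous k := by
  refine ⟨fun hp m hm => ?_, homInt_of_isHomogeneous⟩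
  have := hp hm
  rw [weight_unitWeight] at this
  exact_mod_cast this

lemma HomInt.eq_zero_or {p : MvPolynomial (Fin n) ℂ} {z : ℤ} (hp : HomInt p z) :
    p = 0 ∨ ∃ k : ℕ, (k : ℤ) = z ∧ p.IsHomogeneous k := by
  by_cases h : p = 0
  · exact Or.inl h
  obtain ⟨m, hm⟩ := MvPolynomial.ne_zero_iff.1 h
  have hz := hp hm
  rw [weight_unitWeight] at hz
  subst hz
  exact Or.inr ⟨_, rfl, homInt_natCast_iff.1 hp⟩

lemma HomInt.eq_zero_of_constantCoeff_ne {p : MvPolynomial (Fin n) ℂ} {z : ℤ} (hp : HomInt p z)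
    (h : constantCoeff p ≠ 0) : z = 0 := by
  have := hp (d := 0) (by simpa [constantCoeff_eq] using h)
  simpa using this.symm

lemma HomInt.eq_C {p : MvPolynomial (Fin n) ℂ} (hp : HomInt p 0) : p = C (constantCoeff p) := by
  have h : p.IsHomogeneous 0 := homInt_natCast_iff.1 (by simpa using hp)
  have := (totalDegree_zero_iff_isHomogeneous _).2 h
  rw [totalDegree_eq_zero_iff_eq_C] at this
  simpa [constantCoeff_eq] using this

lemma compInt_zero (p : MvPolynomial (Fin n) ℂ) : compInt 0 p = C (constantCoeff p) := by
  have h := HomInt.eq_C (weightedHomogeneousComponent_isWeightedHomogeneous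
    (w := (unitWeight : Fin n → ℤ)) (0 : ℤ) p)
  rw [compInt, h]
  simp [constantCoeff_eq, coeff_weightedHomogeneousComponent]

lemma homInt_compInt (z : ℤ) (p : MvPolynomial (Fin n) ℂ) : HomInt (compInt z p) z :=
  weightedHomogeneousComponent_isWeightedHomogeneous _ _

lemma compInt_mul {q : MvPolynomial (Fin n) ℂ} {y : ℤ} (hq : HomInt q y) (z : ℤ)
    (p : MvPolynomial (Fin n) ℂ) : compInt (z + y) (p * q) = compInt z p * q := by
  let := weightedGradedAlgebra ℂ (unitWeight : Fin n → ℤ)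
  rw [compInt, compInt, ← weightedDecomposition.decompose'_apply,
    ← weightedDecomposition.decompose'_apply]
  exact DirectSum.coe_decompose_mul_add_of_right_mem
    (weightedHomogeneousSubmodule ℂ (unitWeight : Fin n → ℤ)) (a := p) (b := q) (i := z) hq

/-- A homogeneous combination of homogeneous vectors may be rewritten with homogeneous
coefficients. The entry `a` of every vector has its degree shifted by `t a`. -/
lemma sum_compInt_smul {ι κ : Type*} [Fintype κ] {d : κ → ℤ} {t : ι → ℤ} {k : ℤ}
    {r : κ → ι → MvPolynomial (Fin n) ℂ} {x : ι → MvPolynomial (Fin n) ℂ}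
    (hr : ∀ i a, HomInt (r i a) (d i + t a)) (hx : ∀ a, HomInt (x a) (k + t a))
    {h : κ → MvPolynomial (Fin n) ℂ} (hsum : ∑ i, h i • r i = x) :
    ∑ i, compInt (k - d i) (h i) • r i = x := by
  ext1 a
  have := congrArg (compInt (k + t a)) (congrFun hsum a)
  rw [weightedHomogeneousComponent_eq_self (hx a)] at this
  rw [← this]
  simp only [Finset.sum_apply, Pi.smul_apply, smul_eq_mul, map_sum]
  refine Finset.sum_congr rfl fun i _ => ?_
  rw [← compInt_mul (hr i a)]
  congr 2
  ring

/-- A divisor of a nonzero homogeneous polynomial is a constant if its constant term is nonzero: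
the cofactor then has no terms of degree less than that of the product. -/
lemma eq_C_of_mul_isHomogeneous {p s t : MvPolynomial (Fin n) ℂ} {k : ℕ}
    (ht : t.IsHomogeneous k) (ht0 : t ≠ 0) (h : p * s = t) (hp : constantCoeff p ≠ 0) :
    p = C (constantCoeff p) := by
  have hs : ∀ N, ∀ m : Fin n →₀ ℕ, m.degree = N → N < k → coeff m s = 0 := by
    intro N
    induction N using Nat.strong_induction_on with
    | _ N ih =>
      intro m hm hN
      have h0 : coeff m (p * s) = 0 := by
        rw [h]
        exact ht.coeff_eq_zero (by omega)
      rw [coeff_mul, Finset.sum_eq_single (0, m)] at h0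
      · exact (mul_eq_zero.1 h0).resolve_left (by simpa [constantCoeff_eq] using hp)
      · rintro ⟨a, b⟩ hab hne
        rw [Finset.HasAntidiagonal.mem_antidiagonal] at hab
        dsimp only at hab ⊢
        have hdeg : a.degree + b.degree = N := by rw [← hm, ← hab, map_add]
        have ha : a.degree ≠ 0 := by
          intro ha
          rw [Finsupp.degree_eq_zero_iff] at ha
          subst ha
          exact hne (by rw [← hab, zero_add])
        rw [ih b.degree (by omega) b rfl (by omega), mul_zero]
      · simp
  have hp0 : p ≠ 0 := by
    rintro rfl
    simp at hp
  have hs0 : s ≠ 0 := by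
    rintro rfl
    exact ht0 (by rw [← h, mul_zero])
  have hdeg : p.totalDegree + s.totalDegree = k := by
    rw [← totalDegree_mul_of_isDomain hp0 hs0, h, ht.totalDegree ht0]
  obtain ⟨m, hm⟩ := MvPolynomial.ne_zero_iff.1 hs0
  have hk : k ≤ m.degree := not_lt.1 fun hlt => hm (hs _ m rfl hlt)
  have hm' : m.degree ≤ s.totalDegree := le_totalDegree (mem_support_iff.2 hm)
  have := totalDegree_eq_zero_iff_eq_C.1 (show p.totalDegree = 0 by omega)
  simpa [constantCoeff_eq] using this

lemma compInt_natCast (k : ℕ) (p : MvPolynomial (Fin n) ℂ) :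
    compInt k p = homogeneousComponent k p := by
  ext m
  rw [coeff_weightedHomogeneousComponent, weight_unitWeight, homogeneousComponent,
    coeff_weightedHomogeneousComponent]
  simp only [Nat.cast_inj]

lemma sum_compInt_natCast {N : ℕ} {p : MvPolynomial (Fin n) ℂ} (hN : p.totalDegree < N) :
    ∑ k ∈ Finset.range N, compInt (k : ℤ) p = p := by
  simp_rw [compInt_natCast]
  conv_rhs => rw [← sum_homogeneousComponent p]
  refine (Finset.sum_subset (by simpa using hN) fun k _ hk => ?_).symm
  exact homogeneousComponent_eq_zero _ _ (by simpa using hk)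

lemma sum_compInt_smul_of_isHomogeneous {ι κ : Type*} [Fintype κ] {d : κ → ℕ} {k : ℕ}
    {r : κ → ι → MvPolynomial (Fin n) ℂ} {x : ι → MvPolynomial (Fin n) ℂ}
    (hr : ∀ i a, (r i a).IsHomogeneous (d i)) (hx : ∀ a, (x a).IsHomogeneous k)
    {h : κ → MvPolynomial (Fin n) ℂ} (hsum : ∑ i, h i • r i = x) :
    ∑ i, compInt ((k : ℤ) - d i) (h i) • r i = x :=
  sum_compInt_smul (d := fun i => (d i : ℤ)) (t := 0)
    (fun i a => by simpa using homInt_of_isHomogeneous (hr i a))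
    (fun a => by simpa using homInt_of_isHomogeneous (hx a)) hsum

end Graded

/-! ### Minimal generators and uniqueness of minimal resolutions -/

section MinimalGenerators

variable {n m p q : ℕ} {M : Submodule (MvPolynomial (Fin n) ℂ) (Fin n → MvPolynomial (Fin n) ℂ)}

lemma mem_span_image_compl_iff {A V : Type*} [CommRing A] [AddCommGroup V] [Module A V]
    {r : Fin m → V} {j : Fin m} :
    r j ∈ Submodule.span A (r '' {j}ᶜ) ↔ ∃ h : Fin m → A, h j = 1 ∧ ∑ i, h i • r i = 0 := by
  constructor
  · intro hj
    rw [Finsupp.mem_span_image_iff_linearCombination] at hj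
    obtain ⟨l, hl, hs⟩ := hj
    have hlj : l j = 0 := by
      by_contra h
      exact (hl (Finsupp.mem_support_iff.2 h)) rfl
    refine ⟨fun i => Pi.single (M := fun _ => A) j 1 i - l i, by simp [hlj], ?_⟩
    rw [Finsupp.linearCombination_apply,
      Finsupp.sum_fintype l (fun i a => a • r i) (fun i => zero_smul A (r i))] at hs
    simp [sub_smul, Finset.sum_sub_distrib, hs, Pi.single_apply]
  · rintro ⟨h, hj, hs⟩
    rw [← Finset.add_sum_erase _ _ (Finset.mem_univ j), hj, one_smul] at hs
    rw [eq_neg_of_add_eq_zero_left hs]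
    refine neg_mem (Submodule.sum_mem _ fun i hi => Submodule.smul_mem _ _
      (Submodule.subset_span ⟨i, ?_, rfl⟩))
    simpa using hi

lemma mem_span_range_iff {A V : Type*} [CommRing A] [AddCommGroup V] [Module A V]
    {r : Fin m → V} {x : V} :
    x ∈ Submodule.span A (Set.range r) ↔ ∃ h : Fin m → A, ∑ i, h i • r i = x :=
  Submodule.mem_span_range_iff_exists_fun A

/-- Minimality of a family of homogeneous generators is detected on the relations: by the graded
Nakayama lemma, none of them has an invertible coefficient. -/
lemma isMinimalGenerators_iff {r : Fin m → Fin n → MvPolynomial (Fin n) ℂ} :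
    IsMinimalGenerators M r ↔ (∀ j, ∃ k, IsHomogeneousOfDegree (r j) k) ∧
      Submodule.span (MvPolynomial (Fin n) ℂ) (Set.range r) = M ∧
      ∀ h : Fin m → MvPolynomial (Fin n) ℂ, ∑ i, h i • r i = 0 → ∀ i, constantCoeff (h i) = 0 := by
  constructor
  · intro hr
    refine ⟨hr.homogeneous, hr.span_eq, fun h hs j => ?_⟩
    by_contra hj
    choose d hd using hr.homogeneous
    have hs' := sum_compInt_smul_of_isHomogeneous (k := d j) (x := 0) hd
      (fun a => isHomogeneous_zero _ _ _) hs
    refine hr.irredundant j (mem_span_image_compl_iff.2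
      ⟨fun i => C (constantCoeff (h j))⁻¹ * compInt ((d j : ℤ) - d i) (h i), ?_, ?_⟩)
    · simp only [sub_self, compInt_zero, ← C_mul, inv_mul_cancel₀ hj, C_1]
    · simp only [mul_smul, ← Finset.smul_sum, hs', smul_zero]
  · rintro ⟨h1, h2, h3⟩
    refine ⟨h1, h2, fun j hj => ?_⟩
    obtain ⟨h, hj, hs⟩ := mem_span_image_compl_iff.1 hj
    simpa [hj] using h3 h hs j

lemma IsMinimalGenerators.constantCoeff_eq_zero {r : Fin m → Fin n → MvPolynomial (Fin n) ℂ}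
    (hr : IsMinimalGenerators M r) {h : Fin m → MvPolynomial (Fin n) ℂ}
    (hs : ∑ i, h i • r i = 0) (i : Fin m) : constantCoeff (h i) = 0 :=
  (isMinimalGenerators_iff.1 hr).2.2 h hs i

lemma IsMinimalGenerators.mem {r : Fin m → Fin n → MvPolynomial (Fin n) ℂ}
    (hr : IsMinimalGenerators M r) (j : Fin m) : r j ∈ M :=
  hr.span_eq ▸ Submodule.subset_span ⟨j, rfl⟩

lemma IsMinimalGenerators.ne_zero {r : Fin m → Fin n → MvPolynomial (Fin n) ℂ}
    (hr : IsMinimalGenerators M r) (j : Fin m) : r j ≠ 0 := fun h =>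
  hr.irredundant j (h ▸ Submodule.zero_mem _)

lemma IsMinimalGenerators.comp_equiv {r : Fin m → Fin n → MvPolynomial (Fin n) ℂ}
    (hr : IsMinimalGenerators M r) (σ : Fin p ≃ Fin m) : IsMinimalGenerators M (r ∘ σ) := by
  refine isMinimalGenerators_iff.2 ⟨fun j => hr.homogeneous _, ?_, fun h hs i => ?_⟩
  · rw [σ.surjective.range_comp, hr.span_eq]
  · have := hr.constantCoeff_eq_zero (h := h ∘ σ.symm)
      (by rw [← hs, ← σ.sum_comp]; simp) (σ i)
    simpa using this

lemma IsMinimalResolution.sum_smul_rel {d : Fin p → ℕ} {c : Fin q → ℕ}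
    {r : Fin p → Fin n → MvPolynomial (Fin n) ℂ} {A : Fin q → Fin p → MvPolynomial (Fin n) ℂ}
    (hr : IsMinimalResolution M d c r A) (j : Fin q) : ∑ i, A j i • r i = 0 :=
  (hr.exact_rel _).2 (Submodule.subset_span ⟨j, rfl⟩)

lemma IsMinimalResolution.isMinimalGenerators {d : Fin p → ℕ} {c : Fin q → ℕ}
    {r : Fin p → Fin n → MvPolynomial (Fin n) ℂ} {A : Fin q → Fin p → MvPolynomial (Fin n) ℂ}
    (hr : IsMinimalResolution M d c r A) : IsMinimalGenerators M r := by
  refine isMinimalGenerators_iff.2 ⟨fun j => ⟨_, hr.homogeneous_gen j⟩, hr.span_eq, ?_⟩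
  intro h hs i
  obtain ⟨l, rfl⟩ := mem_span_range_iff.1 ((hr.exact_rel h).1 hs)
  simp [hr.minimal]

/-- If all coefficients of the relations between the `r i` have zero constant term, then passing
from the family `r` to another one and back is the identity modulo the irrelevant ideal. -/
lemma map_constantCoeff_mul_eq_one {V : Type*} [AddCommGroup V] [Module (MvPolynomial (Fin n) ℂ) V]
    {r : Fin m → V} {ρ : Fin p → V}
    {T : Matrix (Fin m) (Fin p) (MvPolynomial (Fin n) ℂ)}
    {U : Matrix (Fin p) (Fin m) (MvPolynomial (Fin n) ℂ)}
    (hT : ∀ i, ∑ j, T i j • ρ j = r i) (hU : ∀ j, ∑ i, U j i • r i = ρ j)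
    (hr : ∀ h : Fin m → MvPolynomial (Fin n) ℂ, ∑ i, h i • r i = 0 → ∀ i, constantCoeff (h i) = 0) :
    T.map constantCoeff * U.map constantCoeff = 1 := by
  rw [← Matrix.map_mul, ← sub_eq_zero]
  ext i k
  have h := hr (fun k => (T * U) i k - (1 : Matrix (Fin m) (Fin m) _) i k) ?_ k
  · have h1 : constantCoeff ((1 : Matrix (Fin m) (Fin m) (MvPolynomial (Fin n) ℂ)) i k) =
        (1 : Matrix (Fin m) (Fin m) ℂ) i k := by
      by_cases hik : i = k <;> simp [Matrix.one_apply, hik]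
    rw [map_sub, h1] at h
    rwa [Matrix.sub_apply, Matrix.map_apply, Matrix.zero_apply]
  · simp only [sub_smul, Finset.sum_sub_distrib, Matrix.mul_apply, Finset.sum_smul]
    rw [Finset.sum_comm]
    simp_rw [mul_smul, ← Finset.smul_sum, hU, hT]
    simp [Matrix.one_apply]

/-- Transition matrices between families of homogeneous vectors may be chosen homogeneous. -/
lemma exists_homogeneous_matrix {d : Fin p → ℕ} {k : Fin m → ℕ}
    {r : Fin m → Fin n → MvPolynomial (Fin n) ℂ} {ρ : Fin p → Fin n → MvPolynomial (Fin n) ℂ}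
    (hρ : ∀ j, IsHomogeneousOfDegree (ρ j) (d j)) (hr : ∀ i, IsHomogeneousOfDegree (r i) (k i))
    (hmem : ∀ i, r i ∈ Submodule.span (MvPolynomial (Fin n) ℂ) (Set.range ρ)) :
    ∃ T : Matrix (Fin m) (Fin p) (MvPolynomial (Fin n) ℂ),
      (∀ i j, HomInt (T i j) ((k i : ℤ) - d j)) ∧ ∀ i, ∑ j, T i j • ρ j = r i := by
  choose T hT using fun i => mem_span_range_iff.1 (hmem i)
  exact ⟨fun i j => compInt ((k i : ℤ) - d j) (T i j), fun i j => homInt_compInt _ _,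
    fun i => sum_compInt_smul_of_isHomogeneous hρ (hr i) (hT i)⟩

/-- The degrees of the elements of a minimal family of homogeneous generators are unique. -/
lemma IsMinimalGenerators.exists_equiv {d : Fin p → ℕ}
    {r : Fin m → Fin n → MvPolynomial (Fin n) ℂ} {ρ : Fin p → Fin n → MvPolynomial (Fin n) ℂ}
    (hρ : IsMinimalGenerators M ρ) (hd : ∀ j, IsHomogeneousOfDegree (ρ j) (d j))
    (hr : IsMinimalGenerators M r) :
    ∃ σ : Fin p ≃ Fin m, ∀ j, IsHomogeneousOfDegree (r (σ j)) (d j) := by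
  choose k hk using hr.homogeneous
  obtain ⟨T, hTh, hT⟩ := exists_homogeneous_matrix hd hk (fun i => hρ.span_eq ▸ hr.mem i)
  obtain ⟨U, -, hU⟩ := exists_homogeneous_matrix hk hd (fun i => hr.span_eq ▸ hρ.mem i)
  have hTU := map_constantCoeff_mul_eq_one hT hU (fun h => hr.constantCoeff_eq_zero)
  have hUT := map_constantCoeff_mul_eq_one hU hT (fun h => hρ.constantCoeff_eq_zero)
  obtain rfl : m = p := by
    simpa using Matrix.square_of_invertible _ _ hTU hUT
  have hdet : (T.map constantCoeff).det ≠ 0 := by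
    intro h0
    have := congrArg Matrix.det hTU
    rw [Matrix.det_mul, h0] at this
    simp at this
  rw [Matrix.det_apply] at hdet
  obtain ⟨σ, -, hσ⟩ := Finset.exists_ne_zero_of_sum_ne_zero hdet
  have hσ' : ∏ j, T.map constantCoeff (σ j) j ≠ 0 := fun h => hσ (by rw [h, smul_zero])
  rw [Finset.prod_ne_zero_iff] at hσ'
  refine ⟨σ, fun j => ?_⟩
  have := (hTh (σ j) j).eq_zero_of_constantCoeff_ne (hσ' j (Finset.mem_univ j))
  rw [show d j = k (σ j) by omega]
  exact hk _

/-- A minimal resolution may be transported to any other minimal family of generators of the same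
degrees. -/
lemma IsMinimalResolution.exists_of_isMinimalGenerators {d : Fin p → ℕ} {c : Fin q → ℕ}
    {ρ r : Fin p → Fin n → MvPolynomial (Fin n) ℂ} {A : Fin q → Fin p → MvPolynomial (Fin n) ℂ}
    (hρ : IsMinimalResolution M d c ρ A) (hr : IsMinimalGenerators M r)
    (hd : ∀ j, IsHomogeneousOfDegree (r j) (d j)) :
    ∃ A', IsMinimalResolution M d c r A' := by
  have hρ' := hρ.isMinimalGenerators
  obtain ⟨T, hTh, hT⟩ := exists_homogeneous_matrix hρ.homogeneous_gen hd
    (fun i => hρ.span_eq ▸ hr.mem i)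
  obtain ⟨U, -, hU⟩ := exists_homogeneous_matrix hd hρ.homogeneous_gen
    (fun i => hr.span_eq ▸ hρ'.mem i)
  have hTU := map_constantCoeff_mul_eq_one hT hU (fun h => hr.constantCoeff_eq_zero)
  -- The determinant of `T` is homogeneous of degree zero, and its constant term is invertible.
  have hdeg : HomInt T.det 0 := by
    rw [Matrix.det_apply]
    refine Submodule.sum_mem (weightedHomogeneousSubmodule ℂ unitWeight (0 : ℤ)) fun σ _ => ?_
    have h := IsWeightedHomogeneous.prod Finset.univ (fun j => T (σ j) j) _
      (fun j _ => hTh (σ j) j)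
    rw [Finset.sum_sub_distrib, Equiv.sum_comp σ (fun j => (d j : ℤ)), sub_self] at h
    rcases Int.units_eq_one_or (Equiv.Perm.sign σ) with h1 | h1 <;> rw [h1]
    · simpa using h
    · simpa using h
  have hdet : constantCoeff T.det ≠ 0 := by
    intro h0
    have := congrArg Matrix.det hTU
    rw [Matrix.det_mul, ← RingHom.mapMatrix_apply, ← RingHom.map_det, h0] at this
    simp at this
  have hunit : IsUnit T.det := by
    rw [hdeg.eq_C]
    exact (isUnit_iff_ne_zero.2 hdet).map C
  have hVT := Matrix.nonsing_inv_mul T hunit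
  have hTV := Matrix.mul_nonsing_inv T hunit
  set V := T⁻¹
  -- The homogeneous part of the inverse is again an inverse, so the inverse is homogeneous.
  have hVh : ∀ i j, HomInt (V i j) ((d i : ℤ) - d j) := by
    have hV' : Matrix.of (fun i j => compInt ((d i : ℤ) - d j) (V i j)) * T = 1 := by
      funext i
      have := sum_compInt_smul (κ := Fin p) (d := fun j => (d j : ℤ)) (t := fun a => -(d a : ℤ))
        (k := d i) (r := T) (x := (1 : Matrix (Fin p) (Fin p) _) i) (h := V i)
        (fun i a => hTh i a) (fun a => ?_) ?_
      · rw [← this]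
        ext1 a
        simp [Matrix.mul_apply]
      · by_cases hia : i = a
        · subst hia
          simpa using isWeightedHomogeneous_one ℂ (unitWeight : Fin n → ℤ)
        · rw [Matrix.one_apply_ne hia]
          exact isWeightedHomogeneous_zero ℂ _ _
      · rw [← hVT]
        ext1 a
        simp [Matrix.mul_apply]
    have hVV : Matrix.of (fun i j => compInt ((d i : ℤ) - d j) (V i j)) = V := by
      rw [← mul_one (Matrix.of _), ← hTV, ← mul_assoc, hV', one_mul]
    intro i j
    rw [← hVV]
    exact homInt_compInt _ _
  have hrel : ∀ h : Fin p → MvPolynomial (Fin n) ℂ,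
      ∑ i, h i • r i = ∑ j, Matrix.vecMul h T j • ρ j := by
    intro h
    simp_rw [← hT, Matrix.vecMul, dotProduct, Finset.sum_smul, Finset.smul_sum, mul_smul]
    exact Finset.sum_comm
  have hVrel : ∀ h : Fin p → MvPolynomial (Fin n) ℂ,
      (∑ i, h i • r i = 0) ↔ ∃ l : Fin q → MvPolynomial (Fin n) ℂ,
        h = Matrix.vecMul (∑ j, l j • A j) V := by
    intro h
    rw [hrel, hρ.exact_rel, mem_span_range_iff]
    refine exists_congr fun l => ⟨fun hl => ?_, fun hl => ?_⟩
    · rw [hl, Matrix.vecMul_vecMul, hTV, Matrix.vecMul_one]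
    · rw [hl, Matrix.vecMul_vecMul, hVT, Matrix.vecMul_one]
  have hlin : ∀ l : Fin q → MvPolynomial (Fin n) ℂ,
      Matrix.vecMul (∑ j, l j • A j) V = ∑ j, l j • Matrix.vecMul (A j) V := by
    intro l
    simp_rw [← Matrix.smul_vecMul]
    exact map_sum (Matrix.vecMulLinear V) _ _
  refine ⟨fun j => Matrix.vecMul (A j) V, hd, fun j i => ?_, hr.span_eq, fun h => ?_, ?_,
    fun j i => ?_⟩
  · have : HomInt (Matrix.vecMul (A j) V i) ((c j : ℤ) - d i) := by
      refine IsWeightedHomogeneous.sum _ _ _ fun k _ => ?_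
      rcases hρ.homogeneous_rel j k with h0 | ⟨l, hl, hh⟩
      · rw [h0, zero_mul]
        exact isWeightedHomogeneous_zero ℂ _ _
      · convert (homInt_of_isHomogeneous hh).mul (hVh k i) using 1
        rw [← hl]
        push_cast
        ring
    refine this.eq_zero_or.imp_right ?_
    rintro ⟨k, hk, hh⟩
    exact ⟨k, by omega, hh⟩
  · rw [hVrel, mem_span_range_iff]
    refine exists_congr fun l => ?_
    rw [hlin]
    exact eq_comm
  · rw [Fintype.linearIndependent_iff]
    intro l hl
    refine Fintype.linearIndependent_iff.1 hρ.injective_rel l ?_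
    rw [← hlin] at hl
    have := congrArg (fun v => Matrix.vecMul v T) hl
    simpa [Matrix.vecMul_vecMul, hVT] using this
  · simp [Matrix.vecMul, dotProduct, hρ.minimal]

/-- A minimal family of homogeneous generators of a free module is a basis. -/
lemma IsMinimalGenerators.linearIndependent_of_free [Module.Free (MvPolynomial (Fin n) ℂ) M]
    {r : Fin m → Fin n → MvPolynomial (Fin n) ℂ} (hr : IsMinimalGenerators M r) :
    LinearIndependent (MvPolynomial (Fin n) ℂ) r := by
  let b := Module.finBasis (MvPolynomial (Fin n) ℂ) M
  let ρ := fun j => (b j : Fin n → MvPolynomial (Fin n) ℂ)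
  have hρi : LinearIndependent (MvPolynomial (Fin n) ℂ) ρ :=
    b.linearIndependent.map' M.subtype (Submodule.ker_subtype M)
  have hρs : Submodule.span (MvPolynomial (Fin n) ℂ) (Set.range ρ) = M := by
    have := congrArg (Submodule.map M.subtype) b.span_eq
    rw [Submodule.map_span, ← Set.range_comp, Submodule.map_subtype_top] at this
    exact this
  have hρr := Fintype.linearIndependent_iff.1 hρi
  choose T hT using fun i => mem_span_range_iff.1 (show r i ∈ Submodule.span _ (Set.range ρ) from
    hρs ▸ hr.mem i)
  choose U hU using fun j => mem_span_range_iff.1 (show ρ j ∈ Submodule.span _ (Set.range r) from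
    by
    rw [hr.span_eq]; exact (b j).2)
  have hTU := map_constantCoeff_mul_eq_one (T := T) (U := U) hT hU
    (fun h => hr.constantCoeff_eq_zero)
  have hUT := map_constantCoeff_mul_eq_one (T := U) (U := T) hU hT
    (fun h hs i => by rw [hρr h hs i, map_zero])
  have hcard : m = Module.finrank (MvPolynomial (Fin n) ℂ) M := by
    simpa using Matrix.square_of_invertible _ _ hTU hUT
  have hUT1 : Matrix.of U * Matrix.of T = 1 := by
    rw [← sub_eq_zero]
    funext i k
    refine hρr ((Matrix.of U * Matrix.of T - 1 : Matrix _ _ (MvPolynomial (Fin n) ℂ)) i) ?_ k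
    simp only [Matrix.sub_apply, sub_smul, Finset.sum_sub_distrib, Matrix.mul_apply,
      Finset.sum_smul, Matrix.of_apply]
    rw [Finset.sum_comm]
    simp_rw [mul_smul, ← Finset.smul_sum, hT, hU]
    simp [Matrix.one_apply]
  have hTU1 : Matrix.of T * Matrix.of U = 1 :=
    (Matrix.mul_eq_one_comm_of_card_eq _ _ _ (by simpa using hcard.symm)).1 hUT1
  rw [Fintype.linearIndependent_iff]
  intro h hs
  have hhT : Matrix.vecMul h (Matrix.of T) = 0 := by
    ext1 j
    refine hρr (Matrix.vecMul h (Matrix.of T)) ?_ j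
    rw [← hs]
    simp_rw [← hT, Matrix.vecMul, dotProduct, Finset.sum_smul, Finset.smul_sum, mul_smul]
    exact Finset.sum_comm
  have := congrArg (fun v => Matrix.vecMul v (Matrix.of U)) hhT
  rw [Matrix.vecMul_vecMul, hTU1, Matrix.vecMul_one, Matrix.zero_vecMul] at this
  exact congrFun this

/-- A graded submodule has a minimal family of homogeneous generators. -/
lemma exists_isMinimalGenerators
    (hM : ∀ δ ∈ M, ∀ k : ℕ, (fun i => compInt (k : ℤ) (δ i)) ∈ M) :
    ∃ (m : ℕ) (r : Fin m → Fin n → MvPolynomial (Fin n) ℂ), IsMinimalGenerators M r := by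
  classical
  have hspan : Submodule.span (MvPolynomial (Fin n) ℂ)
      {δ | δ ∈ M ∧ ∃ k, IsHomogeneousOfDegree δ k} = M := by
    refine le_antisymm (Submodule.span_le.2 fun δ hδ => hδ.1) fun δ hδ => ?_
    let N := (Finset.univ.sup fun i => (δ i).totalDegree) + 1
    have : δ = ∑ k ∈ Finset.range N, fun i => compInt (k : ℤ) (δ i) := by
      ext1 i
      rw [Finset.sum_apply, sum_compInt_natCast]
      exact Nat.lt_succ_of_le (Finset.le_sup (f := fun i => (δ i).totalDegree)
        (Finset.mem_univ i))
    rw [this]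
    exact Submodule.sum_mem _ fun k _ => Submodule.subset_span
      ⟨hM δ hδ k, k, fun i => homInt_natCast_iff.1 (homInt_compInt _ _)⟩
  have hex : ∃ (m : ℕ) (r : Fin m → Fin n → MvPolynomial (Fin n) ℂ),
      (∀ j, ∃ k, IsHomogeneousOfDegree (r j) k) ∧
      Submodule.span (MvPolynomial (Fin n) ℂ) (Set.range r) = M := by
    obtain ⟨s, hs, hs'⟩ := (Submodule.fg_span_iff_fg_span_finset_subset _).1
      (hspan.symm ▸ IsNoetherian.noetherian M)
    refine ⟨s.card, fun i => s.equivFin.symm i, fun j => (hs (s.equivFin.symm j).2).2, ?_⟩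
    rw [← hspan, hs']
    congr 1
    ext x
    constructor
    · rintro ⟨i, rfl⟩
      exact (s.equivFin.symm i).2
    · intro hx
      exact ⟨s.equivFin ⟨x, hx⟩, by simp⟩
  obtain ⟨r, hr, hrs⟩ := Nat.find_spec hex
  refine ⟨_, r, hr, hrs, fun j hj => ?_⟩
  generalize hm : Nat.find hex = m at r j
  cases m with
  | zero => exact j.elim0
  | succ m =>
    refine Nat.find_min hex (m := m) (by omega) ⟨r ∘ j.succAbove, fun i => hr _, ?_⟩
    rw [Set.range_comp, Fin.range_succAbove]
    refine le_antisymm ?_ ?_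
    · rw [← hrs]
      exact Submodule.span_mono (Set.image_subset_range _ _)
    · rw [← hrs, Submodule.span_le]
      rintro _ ⟨i, rfl⟩
      by_cases hij : i = j
      · exact hij ▸ hj
      · exact Submodule.subset_span ⟨i, hij, rfl⟩

/-- A member of a minimal family of homogeneous generators of a saturated module has coprime
entries: any vector proportional to it over the fraction field is a polynomial multiple of it. -/
lemma IsMinimalGenerators.exists_eq_smul
    (hsat : ∀ (a : MvPolynomial (Fin n) ℂ) v, a ≠ 0 → a • v ∈ M → v ∈ M)
    {r : Fin m → Fin n → MvPolynomial (Fin n) ℂ} (hr : IsMinimalGenerators M r) (j : Fin m)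
    {u : Fin n → MvPolynomial (Fin n) ℂ} (hu : ∀ a b, u a * r j b = u b * r j a) :
    ∃ h : MvPolynomial (Fin n) ℂ, u = h • r j := by
  let : NormalizedGCDMonoid (MvPolynomial (Fin n) ℂ) := Classical.arbitrary _
  obtain ⟨b, hb⟩ := Function.ne_iff.1 (hr.ne_zero j)
  obtain ⟨s, hs, hs1⟩ := Finset.univ.extract_gcd (r j) ⟨b, Finset.mem_univ b⟩
  set G := Finset.univ.gcd (r j)
  have hrs : r j = G • s := funext fun a => hs a (Finset.mem_univ a)
  have hG0 : G ≠ 0 := by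
    intro h
    rw [hrs, h] at hb
    simp at hb
  -- Expressing the primitive vector `s` by the generators gives a relation with coefficient
  -- `1 - G * c j` at `r j`, so `G` has an invertible constant term.
  have hsM : s ∈ M := hsat G s hG0 (hrs ▸ hr.mem j)
  rw [← hr.span_eq] at hsM
  obtain ⟨c, hc⟩ := mem_span_range_iff.1 hsM
  have hconst := hr.constantCoeff_eq_zero
    (h := fun i => Pi.single (M := fun _ => MvPolynomial (Fin n) ℂ) j 1 i - G * c i) (by
      simp only [sub_smul, Finset.sum_sub_distrib, mul_smul, ← Finset.smul_sum, hc, ← hrs]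
      simp [Pi.single_apply]) j
  have hGc : constantCoeff G ≠ 0 := by
    intro h
    simp [h] at hconst
  obtain ⟨k, hk⟩ := hr.homogeneous j
  have hGC := eq_C_of_mul_isHomogeneous (hk b) hb (hs b (Finset.mem_univ b)).symm hGc
  have hus : ∀ a b, u a * s b = u b * s a := by
    intro a b
    refine mul_left_cancel₀ hG0 ?_
    have := hu a b
    rw [hs a (Finset.mem_univ a), hs b (Finset.mem_univ b)] at this
    linear_combination this
  have hsb : s b ≠ 0 := by
    intro h
    exact hb (by rw [hs b (Finset.mem_univ b), h, mul_zero]; rfl)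
  have hdvd : s b ∣ u b := by
    have h1 : s b ∣ Finset.univ.gcd fun a => u b * s a :=
      Finset.dvd_gcd fun a _ => ⟨u a, by rw [← hus a b, mul_comm]⟩
    have h2 := h1.trans (Finset.univ.gcd_mul_left' (f := s) (u b)).dvd
    rwa [hs1, mul_one] at h2
  obtain ⟨h, hh⟩ := hdvd
  refine ⟨h * C (constantCoeff G)⁻¹, ?_⟩
  have hinv : C (constantCoeff G)⁻¹ * G = 1 := by
    conv_lhs => rw [hGC]
    simp [← C_mul, hGc]
  ext1 a
  refine mul_right_cancel₀ hsb ?_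
  rw [hus a b, hh, Pi.smul_apply, smul_eq_mul, hs a (Finset.mem_univ a)]
  linear_combination (-h * s a * s b) * hinv

end MinimalGenerators

/-! ### Adjoining the variable `w` -/

section Lift

lemma lift_injective : Function.Injective lift :=
  rename_injective _ (Fin.castSucc_injective 3)

@[simp] lemma lift_zero : lift 0 = 0 := map_zero (rename Fin.castSucc)
@[simp] lemma lift_add (p q) : lift (p + q) = lift p + lift q := map_add (rename Fin.castSucc) p q
@[simp] lemma lift_sub (p q) : lift (p - q) = lift p - lift q := map_sub (rename Fin.castSucc) p q
@[simp] lemma lift_mul (p q) : lift (p * q) = lift p * lift q := map_mul (rename Fin.castSucc) p q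
@[simp] lemma lift_C (a : ℂ) : lift (C a) = C a := rename_C _ _
@[simp] lemma lift_X (i : Fin 3) : lift (X i) = X i.castSucc := rename_X _ _
@[simp] lemma lift_natCast (k : ℕ) : lift k = k := map_natCast (rename Fin.castSucc) k
lemma lift_sum {ι : Type*} (s : Finset ι) (f : ι → MvPolynomial (Fin 3) ℂ) :
    lift (∑ i ∈ s, f i) = ∑ i ∈ s, lift (f i) := map_sum (rename Fin.castSucc) f s

lemma lift_eq_zero_iff {p : MvPolynomial (Fin 3) ℂ} : lift p = 0 ↔ p = 0 :=
  map_eq_zero_iff (rename Fin.castSucc) lift_injective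

lemma isHomogeneous_lift_iff {p : MvPolynomial (Fin 3) ℂ} {k : ℕ} :
    (lift p).IsHomogeneous k ↔ p.IsHomogeneous k :=
  IsHomogeneous.rename_isHomogeneous_iff (Fin.castSucc_injective 3)

lemma constantCoeff_lift (p : MvPolynomial (Fin 3) ℂ) :
    constantCoeff (lift p) = constantCoeff p := constantCoeff_rename _ _

/-- Restriction of polynomials to the plane `w = 0`. -/
def restrict : MvPolynomial (Fin 4) ℂ →ₐ[ℂ] MvPolynomial (Fin 3) ℂ :=
  aeval ![X 0, X 1, X 2, 0]

@[simp] lemma restrict_X_three : restrict (X 3) = 0 := by simp [restrict]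

@[simp] lemma restrict_lift (p : MvPolynomial (Fin 3) ℂ) : restrict (lift p) = p := by
  rw [restrict, lift, aeval_rename]
  conv_rhs => rw [← aeval_X_left_apply p]
  congr 2
  ext1 i
  fin_cases i <;> rfl

lemma isHomogeneous_restrict {p : MvPolynomial (Fin 4) ℂ} {k : ℕ} (hp : p.IsHomogeneous k) :
    (restrict p).IsHomogeneous k := by
  have h : ∀ i, (![X 0, X 1, X 2, 0] i : MvPolynomial (Fin 3) ℂ).IsHomogeneous 1 := by
    intro i
    fin_cases i
    exacts [isHomogeneous_X ℂ 0, isHomogeneous_X ℂ 1, isHomogeneous_X ℂ 2, isHomogeneous_zero _ _ _]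
  rw [← one_mul k]
  exact hp.aeval _ h

lemma constantCoeff_restrict (p : MvPolynomial (Fin 4) ℂ) :
    constantCoeff (restrict p) = constantCoeff p := by
  have : (constantCoeff.comp restrict.toRingHom : MvPolynomial (Fin 4) ℂ →+* ℂ) =
      constantCoeff := by
    refine ringHom_ext (fun a => by simp) fun i => ?_
    fin_cases i <;> simp [restrict]
  exact RingHom.congr_fun this p

lemma exists_eq_lift_restrict_add (p : MvPolynomial (Fin 4) ℂ) :
    ∃ t, p = lift (restrict p) + X 3 * t := by
  induction p using MvPolynomial.induction_on with
  | C a => exact ⟨0, by simp [restrict]⟩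
  | add p q hp hq =>
    obtain ⟨s, hs⟩ := hp
    obtain ⟨t, ht⟩ := hq
    refine ⟨s + t, ?_⟩
    rw [map_add, lift_add]
    linear_combination hs + ht
  | mul_X p i hp =>
    obtain ⟨s, hs⟩ := hp
    induction i using Fin.lastCases with
    | last =>
      refine ⟨p, ?_⟩
      rw [map_mul, show (Fin.last 3) = 3 from rfl, restrict_X_three]
      simp [mul_comm]
    | cast i =>
      refine ⟨s * X i.castSucc, ?_⟩
      rw [map_mul, ← lift_X, restrict_lift, lift_mul]
      linear_combination hs * lift (X i)

/-- Polynomials in `x, y, z, w` as polynomials in `w` with coefficients in `ℂ[x, y, z]`. -/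
def toPolynomial : MvPolynomial (Fin 4) ℂ ≃ₐ[ℂ] Polynomial (MvPolynomial (Fin 3) ℂ) :=
  (renameEquiv ℂ finSuccEquivLast).trans (optionEquivLeft ℂ (Fin 3))

lemma toPolynomial_lift (p : MvPolynomial (Fin 3) ℂ) :
    toPolynomial (lift p) = Polynomial.C p := by
  induction p using MvPolynomial.induction_on with
  | C a => simp [toPolynomial]
  | add p q hp hq => simp [hp, hq]
  | mul_X p i hp =>
    rw [lift_mul, map_mul, map_mul, hp, lift_X]
    simp [toPolynomial]

lemma toPolynomial_X_three : toPolynomial (X 3) = Polynomial.X := by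
  have : finSuccEquivLast (3 : Fin 4) = none := finSuccEquivLast_last
  simp [toPolynomial, this]

/-- The coefficient of `w ^ k`. -/
def wCoeff (k : ℕ) (p : MvPolynomial (Fin 4) ℂ) : MvPolynomial (Fin 3) ℂ :=
  (toPolynomial p).coeff k

lemma wCoeff_sum_mul_lift {ι : Type*} [Fintype ι] (k : ℕ) (p : ι → MvPolynomial (Fin 4) ℂ)
    (q : ι → MvPolynomial (Fin 3) ℂ) :
    wCoeff k (∑ i, p i * lift (q i)) = ∑ i, wCoeff k (p i) * q i := by
  simp [wCoeff, toPolynomial_lift, Polynomial.finsetSum_coeff]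

lemma sum_wCoeff {N : ℕ} {p : MvPolynomial (Fin 4) ℂ} (hN : (toPolynomial p).natDegree < N) :
    ∑ k ∈ Finset.range N, X 3 ^ k * lift (wCoeff k p) = p := by
  apply toPolynomial.injective
  conv_rhs => rw [(toPolynomial p).as_sum_range' N hN]
  simp only [map_sum, map_mul, map_pow, toPolynomial_lift, toPolynomial_X_three, wCoeff,
    ← Polynomial.C_mul_X_pow_eq_monomial, mul_comm]

/-- The vector of polynomials in `x, y, z, w` given by polynomials in `x, y, z`. -/
def liftVec {ι : Type*} (v : ι → MvPolynomial (Fin 3) ℂ) : ι → MvPolynomial (Fin 4) ℂ :=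
  fun i => lift (v i)

lemma liftVec_sum_smul {ι κ : Type*} [Fintype κ] (h : κ → MvPolynomial (Fin 3) ℂ)
    (r : κ → ι → MvPolynomial (Fin 3) ℂ) :
    liftVec (∑ j, h j • r j) = ∑ j, lift (h j) • liftVec (r j) := by
  ext1 i
  simp [liftVec, lift_sum]

lemma restrict_sum_smul_liftVec {ι κ : Type*} [Fintype κ] (h : κ → MvPolynomial (Fin 4) ℂ)
    (r : κ → ι → MvPolynomial (Fin 3) ℂ) (i : ι) :
    restrict ((∑ j, h j • liftVec (r j)) i) = (∑ j, restrict (h j) • r j) i := by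
  simp [liftVec]

/-- The solutions over `ℂ[x, y, z, w]` of a linear system over `ℂ[x, y, z]` are generated by its
solutions over `ℂ[x, y, z]`: compare coefficients of powers of `w`. -/
lemma mem_span_liftVec_of_forall {ι κ : Type*} [Fintype ι] (a : κ → ι → MvPolynomial (Fin 3) ℂ)
    {h : ι → MvPolynomial (Fin 4) ℂ} (hh : ∀ k, ∑ i, h i * lift (a k i) = 0) :
    h ∈ Submodule.span (MvPolynomial (Fin 4) ℂ) (liftVec '' {u | ∀ k, ∑ i, u i * a k i = 0}) := by
  let N := (Finset.univ.sup fun i => (toPolynomial (h i)).natDegree) + 1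
  have : h = ∑ k ∈ Finset.range N, (X 3 : MvPolynomial (Fin 4) ℂ) ^ k •
      liftVec fun i => wCoeff k (h i) := by
    ext1 i
    simp only [Finset.sum_apply, Pi.smul_apply, smul_eq_mul, liftVec]
    exact (sum_wCoeff (Nat.lt_succ_of_le (Finset.le_sup
      (f := fun i => (toPolynomial (h i)).natDegree) (Finset.mem_univ i)))).symm
  rw [this]
  refine Submodule.sum_mem _ fun k _ => Submodule.smul_mem _ _ (Submodule.subset_span
    ⟨_, fun l => ?_, rfl⟩)
  rw [← wCoeff_sum_mul_lift, hh, wCoeff, map_zero, Polynomial.coeff_zero]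

lemma liftVec_mem_span {ι : Type*} {q : ℕ} {A : Fin q → ι → MvPolynomial (Fin 3) ℂ}
    {u : ι → MvPolynomial (Fin 3) ℂ}
    (hu : u ∈ Submodule.span (MvPolynomial (Fin 3) ℂ) (Set.range A)) :
    liftVec u ∈ Submodule.span (MvPolynomial (Fin 4) ℂ) (Set.range fun j => liftVec (A j)) := by
  obtain ⟨l, rfl⟩ := mem_span_range_iff.1 hu
  rw [liftVec_sum_smul]
  exact mem_span_range_iff.2 ⟨_, rfl⟩

/-- Flatness of `ℂ[x, y, z, w]` over `ℂ[x, y, z]`: relations between vectors over the smaller ring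
are generated by relations over that ring. -/
lemma sum_smul_liftVec_eq_zero {ι : Type*} {p q : ℕ} {r : Fin p → ι → MvPolynomial (Fin 3) ℂ}
    {A : Fin q → Fin p → MvPolynomial (Fin 3) ℂ}
    (hA : ∀ u : Fin p → MvPolynomial (Fin 3) ℂ, ∑ j, u j • r j = 0 →
      u ∈ Submodule.span (MvPolynomial (Fin 3) ℂ) (Set.range A))
    {h : Fin p → MvPolynomial (Fin 4) ℂ} (hh : ∑ j, h j • liftVec (r j) = 0) :
    h ∈ Submodule.span (MvPolynomial (Fin 4) ℂ) (Set.range fun j => liftVec (A j)) := by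
  refine Submodule.span_le.2 ?_ (mem_span_liftVec_of_forall (fun i j => r j i) (h := h)
    fun i => by simpa [liftVec] using congrFun hh i)
  rintro _ ⟨u, hu, rfl⟩
  refine liftVec_mem_span (hA u ?_)
  ext1 i
  simpa using hu i

lemma linearIndependent_liftVec {ι : Type*} {q : ℕ} {A : Fin q → ι → MvPolynomial (Fin 3) ℂ}
    (hA : LinearIndependent (MvPolynomial (Fin 3) ℂ) A) :
    LinearIndependent (MvPolynomial (Fin 4) ℂ) fun j => liftVec (A j) := by
  rw [Fintype.linearIndependent_iff] at hA ⊢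
  intro l hl
  have := sum_smul_liftVec_eq_zero (q := 0) (A := Fin.elim0) (fun u hu => by
    rw [show u = 0 from funext (hA u hu)]
    exact zero_mem _) hl
  rw [Set.range_eq_empty, Submodule.span_empty, Submodule.mem_bot] at this
  exact congrFun this

end Lift

/-! ### Derivations killing the equation of the cone -/

section Cone

/-- A derivation in `x, y, z`, with coefficients involving `w`, as a derivation in `x, y, z, w`. -/
def horizontal : (Fin 3 → MvPolynomial (Fin 4) ℂ) →ₗ[MvPolynomial (Fin 4) ℂ]
    (Fin 4 → MvPolynomial (Fin 4) ℂ) where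
  toFun u := ![u 0, u 1, u 2, 0]
  map_add' u v := by ext1 i; fin_cases i <;> simp
  map_smul' a u := by ext1 i; fin_cases i <;> simp

lemma horizontal_castSucc (u : Fin 3 → MvPolynomial (Fin 4) ℂ) (i : Fin 3) :
    horizontal u i.castSucc = u i := by
  fin_cases i <;> rfl

lemma horizontal_three (u : Fin 3 → MvPolynomial (Fin 4) ℂ) : horizontal u 3 = 0 := rfl

lemma horizontal_injective : Function.Injective horizontal := by
  intro u v h
  ext1 i
  rw [← horizontal_castSucc u, h, horizontal_castSucc]

lemma extend_eq (r : Fin 3 → MvPolynomial (Fin 3) ℂ) : extend r = horizontal (liftVec r) := rfl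

lemma coneEuler_castSucc (e : ℕ) (i : Fin 3) : coneEuler e i.castSucc = X i.castSucc := by
  fin_cases i <;> rfl

lemma coneEuler_three (e : ℕ) : coneEuler e 3 = -(e : MvPolynomial (Fin 4) ℂ) * X 3 := rfl

lemma isHomogeneousOfDegree_extend_iff {r : Fin 3 → MvPolynomial (Fin 3) ℂ} {k : ℕ} :
    IsHomogeneousOfDegree (extend r) k ↔ IsHomogeneousOfDegree r k := by
  constructor
  · intro h i
    have := h i.castSucc
    rw [extend_eq, horizontal_castSucc] at this
    exact isHomogeneous_lift_iff.1 this
  · intro h i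
    induction i using Fin.lastCases with
    | last => exact isHomogeneous_zero _ _ _
    | cast i =>
      rw [extend_eq, horizontal_castSucc]
      exact isHomogeneous_lift_iff.2 (h i)

lemma isHomogeneousOfDegree_coneEuler (e : ℕ) : IsHomogeneousOfDegree (coneEuler e) 1 := by
  intro i
  induction i using Fin.lastCases with
  | last =>
    rw [show Fin.last 3 = 3 from rfl, coneEuler_three]
    have := (isHomogeneous_X ℂ (3 : Fin 4)).C_mul (-(e : ℂ))
    simpa using this
  | cast i =>
    rw [coneEuler_castSucc]
    exact isHomogeneous_X _ _

lemma mem_D0 {n : ℕ} {f : MvPolynomial (Fin n) ℂ} {δ : Fin n → MvPolynomial (Fin n) ℂ} :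
    δ ∈ D0 f ↔ ∑ i, δ i * pderiv i f = 0 := Iff.rfl

lemma mem_D0_of_smul_mem {n : ℕ} {f : MvPolynomial (Fin n) ℂ} (a : MvPolynomial (Fin n) ℂ)
    (δ : Fin n → MvPolynomial (Fin n) ℂ) (ha : a ≠ 0) (h : a • δ ∈ D0 f) : δ ∈ D0 f := by
  rw [mem_D0] at h ⊢
  simp only [Pi.smul_apply, smul_eq_mul, mul_assoc, ← Finset.mul_sum] at h
  exact (mul_eq_zero.1 h).resolve_left ha

lemma compInt_mem_D0 {n e : ℕ} {f : MvPolynomial (Fin n) ℂ} (hf : f.IsHomogeneous e)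
    {δ : Fin n → MvPolynomial (Fin n) ℂ} (hδ : δ ∈ D0 f) (z : ℤ) :
    (fun i => compInt z (δ i)) ∈ D0 f := by
  rw [mem_D0] at hδ ⊢
  simp_rw [← compInt_mul (homInt_of_isHomogeneous hf.pderiv), ← map_sum, hδ, map_zero]

variable {g : MvPolynomial (Fin 3) ℂ} {e : ℕ}

lemma pderiv_castSucc_cone (g : MvPolynomial (Fin 3) ℂ) (i : Fin 3) :
    pderiv i.castSucc (cone g) = X 3 * lift (pderiv i g) := by
  have h : (3 : Fin 4) ≠ i.castSucc := (Fin.castSucc_lt_last i).ne'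
  rw [cone, pderiv_mul, pderiv_X_of_ne h, lift, pderiv_rename (Fin.castSucc_injective 3)]
  simp [lift]

lemma pderiv_three_cone (g : MvPolynomial (Fin 3) ℂ) : pderiv 3 (cone g) = lift g := by
  have h : pderiv 3 (lift g) = 0 := by
    refine pderiv_eq_zero_of_notMem_vars fun hv => ?_
    obtain ⟨i, -, hi⟩ := mem_vars_rename _ _ hv
    exact (Fin.castSucc_lt_last i).ne hi
  rw [cone, pderiv_mul, h, pderiv_X_self]
  simp

lemma mem_D0_cone {δ : Fin 4 → MvPolynomial (Fin 4) ℂ} :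
    δ ∈ D0 (cone g) ↔
      X 3 * ∑ i : Fin 3, δ i.castSucc * lift (pderiv i g) + δ 3 * lift g = 0 := by
  rw [mem_D0, Fin.sum_univ_castSucc]
  simp_rw [pderiv_castSucc_cone]
  rw [show Fin.last 3 = 3 from rfl, pderiv_three_cone, Finset.mul_sum]
  simp_rw [mul_left_comm]

lemma horizontal_mem_D0_cone {u : Fin 3 → MvPolynomial (Fin 4) ℂ} :
    horizontal u ∈ D0 (cone g) ↔ ∑ i, u i * lift (pderiv i g) = 0 := by
  rw [mem_D0_cone, horizontal_three, zero_mul, add_zero]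
  simp_rw [horizontal_castSucc]
  exact ⟨fun h => (mul_eq_zero.1 h).resolve_left (X_ne_zero _), fun h => by rw [h, mul_zero]⟩

lemma extend_mem_D0_cone {r : Fin 3 → MvPolynomial (Fin 3) ℂ} :
    extend r ∈ D0 (cone g) ↔ r ∈ D0 g := by
  rw [extend_eq, horizontal_mem_D0_cone, mem_D0, ← lift_eq_zero_iff, lift_sum]
  simp [liftVec]

lemma sum_X_mul_lift_pderiv (hg : g.IsHomogeneous e) :
    ∑ i : Fin 3, X i.castSucc * lift (pderiv i g) = e * lift g := by
  have := congrArg lift hg.sum_X_mul_pderiv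
  simpa [lift_sum] using this

lemma coneEuler_mem_D0_cone (hg : g.IsHomogeneous e) : coneEuler e ∈ D0 (cone g) := by
  rw [mem_D0_cone]
  simp_rw [coneEuler_castSucc]
  rw [sum_X_mul_lift_pderiv hg, coneEuler_three]
  ring

/-- The splitting of `D₀` of the cone: every element is the sum of a multiple of the Euler-type
derivation and of a derivation in `x, y, z` killing `g`. Indeed `w` divides its last entry. -/
lemma exists_eq_smul_coneEuler_add (hg : g.IsHomogeneous e) (hg0 : g ≠ 0) (he : e ≠ 0)
    {δ : Fin 4 → MvPolynomial (Fin 4) ℂ} (hδ : δ ∈ D0 (cone g)) :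
    ∃ (h : MvPolynomial (Fin 4) ℂ) (u : Fin 3 → MvPolynomial (Fin 4) ℂ),
      ∑ i, u i * lift (pderiv i g) = 0 ∧ δ = h • coneEuler e + horizontal u := by
  rw [mem_D0_cone] at hδ
  have hdvd : restrict (δ 3) = 0 := by
    have := congrArg restrict hδ
    simpa [hg0] using this
  obtain ⟨t, ht⟩ := exists_eq_lift_restrict_add (δ 3)
  rw [hdvd, lift_zero, zero_add] at ht
  have hinv : C (e : ℂ)⁻¹ * (e : MvPolynomial (Fin 4) ℂ) = 1 := by
    rw [← map_natCast C e, ← C_mul, inv_mul_cancel₀ (by exact_mod_cast he), C_1]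
  have hsum : ∑ i : Fin 3, δ i.castSucc * lift (pderiv i g) + t * lift g = 0 := by
    refine mul_left_cancel₀ (X_ne_zero (R := ℂ) (3 : Fin 4)) ?_
    rw [ht] at hδ
    linear_combination hδ
  refine ⟨-C (e : ℂ)⁻¹ * t, fun i => δ i.castSucc + C (e : ℂ)⁻¹ * t * X i.castSucc, ?_, ?_⟩
  · simp only [add_mul, Finset.sum_add_distrib, mul_assoc, ← Finset.mul_sum]
    rw [sum_X_mul_lift_pderiv hg]
    linear_combination hsum + t * lift g * hinv
  · ext1 i
    induction i using Fin.lastCases with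
    | last =>
      rw [show Fin.last 3 = 3 from rfl, Pi.add_apply, Pi.smul_apply, horizontal_three,
        coneEuler_three, ht, smul_eq_mul]
      linear_combination -X 3 * t * hinv
    | cast i =>
      rw [Pi.add_apply, Pi.smul_apply, horizontal_castSucc, coneEuler_castSucc, smul_eq_mul]
      ring

lemma sum_smul_coneFamily {m : ℕ} (r : Fin m → Fin 3 → MvPolynomial (Fin 3) ℂ)
    (h : Fin (m + 1) → MvPolynomial (Fin 4) ℂ) :
    ∑ i, h i • coneFamily e r i =
      h 0 • coneEuler e + horizontal (∑ j, h j.succ • liftVec (r j)) := by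
  rw [Fin.sum_univ_succ, map_sum]
  simp [coneFamily, extend_eq]

lemma smul_coneEuler_add_horizontal_eq_horizontal (he : e ≠ 0) {h : MvPolynomial (Fin 4) ℂ}
    {u v : Fin 3 → MvPolynomial (Fin 4) ℂ} :
    h • coneEuler e + horizontal u = horizontal v ↔ h = 0 ∧ u = v := by
  constructor
  · intro H
    have h3 := congrFun H 3
    rw [Pi.add_apply, Pi.smul_apply, horizontal_three, horizontal_three, coneEuler_three] at h3
    have : h = 0 := by simpa [he] using h3
    subst this
    rw [zero_smul, zero_add] at H
    exact ⟨rfl, horizontal_injective H⟩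
  · rintro ⟨rfl, rfl⟩
    rw [zero_smul, zero_add]

lemma sum_smul_coneFamily_eq_zero_iff (he : e ≠ 0) {m : ℕ}
    {r : Fin m → Fin 3 → MvPolynomial (Fin 3) ℂ} {h : Fin (m + 1) → MvPolynomial (Fin 4) ℂ} :
    ∑ i, h i • coneFamily e r i = 0 ↔ h 0 = 0 ∧ ∑ j, h j.succ • liftVec (r j) = 0 := by
  rw [sum_smul_coneFamily, ← map_zero horizontal, smul_coneEuler_add_horizontal_eq_horizontal he]

lemma span_coneFamily (hg : g.IsHomogeneous e) (hg0 : g ≠ 0) (he : e ≠ 0) {m : ℕ}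
    {r : Fin m → Fin 3 → MvPolynomial (Fin 3) ℂ}
    (hr : Submodule.span (MvPolynomial (Fin 3) ℂ) (Set.range r) = D0 g) :
    Submodule.span (MvPolynomial (Fin 4) ℂ) (Set.range (coneFamily e r)) = D0 (cone g) := by
  refine le_antisymm (Submodule.span_le.2 ?_) fun δ hδ => ?_
  · rintro _ ⟨i, rfl⟩
    induction i using Fin.cases with
    | zero => exact coneEuler_mem_D0_cone hg
    | succ i => exact extend_mem_D0_cone.2 (hr ▸ Submodule.subset_span ⟨i, rfl⟩)
  · obtain ⟨h, u, hu, rfl⟩ := exists_eq_smul_coneEuler_add hg hg0 he hδ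
    have hu' : u ∈ Submodule.span (MvPolynomial (Fin 4) ℂ)
        (Set.range fun j => liftVec (r j)) := by
      refine Submodule.span_le.2 ?_
        (mem_span_liftVec_of_forall (fun (_ : Unit) i => pderiv i g) fun _ => hu)
      rintro _ ⟨v, hv, rfl⟩
      exact liftVec_mem_span (hr ▸ hv ())
    obtain ⟨l, rfl⟩ := mem_span_range_iff.1 hu'
    refine mem_span_range_iff.2 ⟨Fin.cons h l, ?_⟩
    rw [sum_smul_coneFamily]
    simp

lemma IsMinimalGenerators.coneFamily (hg : g.IsHomogeneous e) (hg0 : g ≠ 0) (he : e ≠ 0) {m : ℕ}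
    {r : Fin m → Fin 3 → MvPolynomial (Fin 3) ℂ} (hr : IsMinimalGenerators (D0 g) r) :
    IsMinimalGenerators (D0 (cone g)) (coneFamily e r) := by
  refine isMinimalGenerators_iff.2 ⟨fun j => ?_, span_coneFamily hg hg0 he hr.span_eq,
    fun h hs i => ?_⟩
  · induction j using Fin.cases with
    | zero => exact ⟨1, isHomogeneousOfDegree_coneEuler e⟩
    | succ j =>
      obtain ⟨k, hk⟩ := hr.homogeneous j
      exact ⟨k, isHomogeneousOfDegree_extend_iff.2 hk⟩
  · obtain ⟨h0, hs⟩ := (sum_smul_coneFamily_eq_zero_iff he).1 hs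
    induction i using Fin.cases with
    | zero => rw [h0, map_zero]
    | succ i =>
      rw [← constantCoeff_restrict]
      refine hr.constantCoeff_eq_zero (h := fun j => restrict (h j.succ)) ?_ i
      ext1 k
      rw [← restrict_sum_smul_liftVec, hs]
      simp

lemma sum_smul_cons_zero {p q : ℕ} {A : Type*} [CommRing A] (l : Fin q → A)
    (B : Fin q → Fin p → A) :
    ∑ j, l j • (Fin.cons 0 (B j) : Fin (p + 1) → A) = Fin.cons 0 (∑ j, l j • B j) := by
  ext1 i
  induction i using Fin.cases <;> simp

lemma IsMinimalResolution.coneFamily (hg : g.IsHomogeneous e) (hg0 : g ≠ 0) (he : e ≠ 0)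
    {p q : ℕ} {d : Fin p → ℕ} {c : Fin q → ℕ} {r : Fin p → Fin 3 → MvPolynomial (Fin 3) ℂ}
    {A : Fin q → Fin p → MvPolynomial (Fin 3) ℂ} (hr : IsMinimalResolution (D0 g) d c r A) :
    IsMinimalResolution (D0 (cone g)) (Fin.cons 1 d : Fin (p + 1) → ℕ) c (coneFamily e r)
      (fun j => Fin.cons 0 fun i => lift (A j i)) := by
  have hcons : ∀ l : Fin q → MvPolynomial (Fin 4) ℂ,
      ∑ j, l j • (Fin.cons 0 (fun i => lift (A j i)) : Fin (p + 1) → MvPolynomial (Fin 4) ℂ) =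
        Fin.cons 0 (∑ j, l j • liftVec (A j)) :=
    fun l => sum_smul_cons_zero l fun j => liftVec (A j)
  refine ⟨fun i => ?_, fun j i => ?_, span_coneFamily hg hg0 he hr.span_eq, fun h => ?_, ?_,
    fun j i => ?_⟩
  · induction i using Fin.cases with
    | zero => exact isHomogeneousOfDegree_coneEuler e
    | succ i => exact isHomogeneousOfDegree_extend_iff.2 (hr.homogeneous_gen i)
  · induction i using Fin.cases with
    | zero => exact Or.inl rfl
    | succ i =>
      simp only [Fin.cons_succ, lift_eq_zero_iff, isHomogeneous_lift_iff]
      exact hr.homogeneous_rel j i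
  · rw [sum_smul_coneFamily_eq_zero_iff he, mem_span_range_iff]
    simp_rw [hcons]
    constructor
    · rintro ⟨h0, hs⟩
      obtain ⟨l, hl⟩ := mem_span_range_iff.1
        (sum_smul_liftVec_eq_zero (fun u hu => (hr.exact_rel u).1 hu) hs)
      refine ⟨l, ?_⟩
      rw [hl, ← h0]
      exact Fin.cons_self_tail h
    · rintro ⟨l, rfl⟩
      refine ⟨rfl, ?_⟩
      simp only [Fin.cons_succ, Finset.sum_apply, Pi.smul_apply, Finset.sum_smul, smul_assoc]
      rw [Finset.sum_comm]
      refine Finset.sum_eq_zero fun j _ => ?_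
      rw [← Finset.smul_sum]
      have := congrArg liftVec (hr.sum_smul_rel j)
      rw [liftVec_sum_smul] at this
      rw [show ∑ i, liftVec (A j) i • liftVec (r i) = _ from this]
      ext1 i
      simp [liftVec]
  · rw [Fintype.linearIndependent_iff]
    intro l hl
    rw [hcons] at hl
    refine Fintype.linearIndependent_iff.1 (linearIndependent_liftVec hr.injective_rel) l ?_
    ext1 i
    simpa using congrFun hl i.succ
  · induction i using Fin.cases with
    | zero => exact map_zero _
    | succ i => exact (constantCoeff_lift _).trans (hr.minimal j i)

/-- Conversely, restricting to `w = 0` a resolution of `D₀` of the cone whose generators come from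
the curve gives a resolution for the curve. -/
lemma IsMinimalResolution.of_coneFamily (he : e ≠ 0)
    {p q : ℕ} {d : Fin (p + 1) → ℕ} {c : Fin q → ℕ} {r : Fin p → Fin 3 → MvPolynomial (Fin 3) ℂ}
    {A : Fin q → Fin (p + 1) → MvPolynomial (Fin 4) ℂ}
    (hr : IsMinimalResolution (D0 (cone g)) d c (JacobianSyzygies.coneFamily e r) A) :
    IsMinimalResolution (D0 g) (fun i => d i.succ) c r fun j i => restrict (A j i.succ) := by
  have hA := fun j => (sum_smul_coneFamily_eq_zero_iff he).1 (hr.sum_smul_rel j)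
  have hlift : ∀ h : Fin p → MvPolynomial (Fin 3) ℂ, (∑ i, h i • r i = 0) →
      ∃ l : Fin q → MvPolynomial (Fin 4) ℂ, ∑ j, l j • A j = Fin.cons 0 fun i => lift (h i) := by
    intro h hs
    refine mem_span_range_iff.1 ((hr.exact_rel _).1 ?_)
    rw [sum_smul_coneFamily_eq_zero_iff he]
    refine ⟨rfl, ?_⟩
    simp only [Fin.cons_succ]
    rw [← liftVec_sum_smul, hs]
    ext1 i
    simp [liftVec]
  refine ⟨fun i => isHomogeneousOfDegree_extend_iff.1 (hr.homogeneous_gen i.succ), fun j i => ?_,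
    le_antisymm (Submodule.span_le.2 ?_) fun u hu => ?_, fun h => ?_, ?_, fun j i => ?_⟩
  · rcases hr.homogeneous_rel j i.succ with h0 | ⟨k, hk, hh⟩
    · exact Or.inl (by rw [h0, map_zero])
    · exact Or.inr ⟨k, hk, isHomogeneous_restrict hh⟩
  · rintro _ ⟨i, rfl⟩
    refine extend_mem_D0_cone.1 (hr.span_eq ▸ Submodule.subset_span ⟨i.succ, rfl⟩)
  · have := extend_mem_D0_cone.2 hu
    rw [← hr.span_eq, mem_span_range_iff] at this
    obtain ⟨h, hh⟩ := this
    rw [sum_smul_coneFamily, extend_eq, smul_coneEuler_add_horizontal_eq_horizontal he] at hh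
    refine mem_span_range_iff.2 ⟨fun j => restrict (h j.succ), ?_⟩
    ext1 i
    rw [← restrict_sum_smul_liftVec, hh.2, liftVec, restrict_lift]
  · rw [mem_span_range_iff]
    constructor
    · intro hs
      obtain ⟨l, hl⟩ := hlift h hs
      refine ⟨fun j => restrict (l j), ?_⟩
      ext1 i
      have := congrArg restrict (congrFun hl i.succ)
      simpa using this
    · rintro ⟨l, rfl⟩
      simp only [Finset.sum_apply, Pi.smul_apply, Finset.sum_smul, smul_assoc]
      rw [Finset.sum_comm]
      refine Finset.sum_eq_zero fun j _ => ?_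
      rw [← Finset.smul_sum]
      convert smul_zero (l j)
      ext1 i
      rw [← restrict_sum_smul_liftVec, (hA j).2]
      simp
  · rw [Fintype.linearIndependent_iff]
    intro l hl
    -- A combination of the restricted relations vanishes: then the same combination of the
    -- relations is `w` times a vector, which is again a relation.
    choose t ht using fun i : Fin p => exists_eq_lift_restrict_add ((∑ j, lift (l j) • A j) i.succ)
    have hB : ∑ j, lift (l j) • A j = (X 3 : MvPolynomial (Fin 4) ℂ) • Fin.cons 0 t := by
      ext1 i
      induction i using Fin.cases with
      | zero => simp [fun j => (hA j).1]
      | succ i =>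
        have h0 : restrict ((∑ j, lift (l j) • A j) i.succ) = 0 := by
          have := congrFun hl i
          simpa using this
        rw [ht i, h0]
        simp
    have hBrel : ∑ i, (Fin.cons 0 t : Fin (p + 1) → MvPolynomial (Fin 4) ℂ) i •
        JacobianSyzygies.coneFamily e r i = 0 := by
      have h1 := (hr.exact_rel _).2 (mem_span_range_iff.2 ⟨_, hB⟩)
      simp only [Pi.smul_apply, smul_assoc, ← Finset.smul_sum] at h1
      exact (smul_eq_zero.1 h1).resolve_left (X_ne_zero _)
    obtain ⟨s, hs⟩ := mem_span_range_iff.1 ((hr.exact_rel _).1 hBrel)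
    have hind := Fintype.linearIndependent_iff.1 hr.injective_rel
      (fun j => lift (l j) - X 3 * s j) (by
        simp only [sub_smul, Finset.sum_sub_distrib, mul_smul, ← Finset.smul_sum, hB, hs, sub_self])
    intro j
    have := congrArg restrict (hind j)
    simpa using this
  · rw [constantCoeff_restrict]
    exact hr.minimal j i.succ

end Cone

/-! ### Tameness -/

section Tame

variable {g : MvPolynomial (Fin 3) ℂ} {e : ℕ}

lemma det_cone (e : ℕ) (a u : Fin 3 → MvPolynomial (Fin 4) ℂ) (h : MvPolynomial (Fin 4) ℂ) :
    (Matrix.of ![fun i => X i, coneEuler e, horizontal a, h • coneEuler e + horizontal u]).det =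
      -((e : MvPolynomial (Fin 4) ℂ) + 1) * X 3 *
        (X 0 * (a 1 * u 2 - a 2 * u 1) + X 1 * (a 2 * u 0 - a 0 * u 2) +
          X 2 * (a 0 * u 1 - a 1 * u 0)) := by
  simp [Matrix.det_succ_row_zero, Fin.sum_univ_succ, coneEuler, horizontal, Fin.succAbove]
  ring

/-- Let `a` and `u` be orthogonal to `G` and coplanar with a vector `x` that is not orthogonal to
`G`. Then `a` and `u` are parallel: their cross product is parallel to `G` and orthogonal to `x`. -/
lemma cross_eq_zero {A : Type*} [CommRing A] [IsDomain A] {x G a u : Fin 3 → A}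
    (ha : ∑ i, a i * G i = 0) (hu : ∑ i, u i * G i = 0) (hx : ∑ i, x i * G i ≠ 0)
    (hdet : x 0 * (a 1 * u 2 - a 2 * u 1) + x 1 * (a 2 * u 0 - a 0 * u 2) +
      x 2 * (a 0 * u 1 - a 1 * u 0) = 0) (i j : Fin 3) : u i * a j - u j * a i = 0 := by
  rw [Fin.sum_univ_three] at ha hu hx
  have h0 : a 1 * u 2 - a 2 * u 1 = 0 := by
    refine (mul_eq_zero.1 ?_).resolve_left hx
    linear_combination G 0 * hdet - x 1 * (a 2 * hu - u 2 * ha) + x 2 * (a 1 * hu - u 1 * ha)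
  have h1 : a 2 * u 0 - a 0 * u 2 = 0 := by
    refine (mul_eq_zero.1 ?_).resolve_left hx
    linear_combination G 1 * hdet - x 2 * (a 0 * hu - u 0 * ha) + x 0 * (a 2 * hu - u 2 * ha)
  have h2 : a 0 * u 1 - a 1 * u 0 = 0 := by
    refine (mul_eq_zero.1 ?_).resolve_left hx
    linear_combination G 2 * hdet - x 0 * (a 1 * hu - u 1 * ha) + x 1 * (a 0 * hu - u 0 * ha)
  fin_cases i <;> fin_cases j <;> simp only [Fin.zero_eta, Fin.mk_one, Fin.reduceFinMk]
  · ring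
  · linear_combination -h2
  · linear_combination h1
  · linear_combination h2
  · ring
  · linear_combination -h0
  · linear_combination -h1
  · linear_combination h0
  · ring

lemma IsMinimalGenerators.isTame (hg : g.IsHomogeneous e) (hg0 : g ≠ 0) (he : e ≠ 0) {m : ℕ}
    {r : Fin m → Fin 3 → MvPolynomial (Fin 3) ℂ} (hr : IsMinimalGenerators (D0 g) r) (j : Fin m) :
    IsTame (cone g) (coneEuler e) (extend (r j)) := by
  refine ⟨coneEuler_mem_D0_cone hg, extend_mem_D0_cone.2 (hr.mem j), ?_, fun δ hδ hdet => ?_⟩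
  · rw [LinearIndependent.pair_iff]
    intro s t hst
    rw [extend_eq, ← map_smul, ← map_zero horizontal,
      smul_coneEuler_add_horizontal_eq_horizontal he] at hst
    refine ⟨hst.1, (smul_eq_zero.1 hst.2).resolve_right fun h => hr.ne_zero j ?_⟩
    ext1 i
    exact lift_eq_zero_iff.1 (congrFun h i)
  · obtain ⟨h, u, hu, rfl⟩ := exists_eq_smul_coneEuler_add hg hg0 he hδ
    have he1 : (e : MvPolynomial (Fin 4) ℂ) + 1 ≠ 0 := by exact_mod_cast e.succ_ne_zero
    rw [extend_eq, det_cone] at hdet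
    have hD := (mul_eq_zero.1 hdet).resolve_left
      (mul_ne_zero (neg_ne_zero.2 he1) (X_ne_zero _))
    have ha : ∑ i, liftVec (r j) i * lift (pderiv i g) = 0 :=
      horizontal_mem_D0_cone.1 (extend_mem_D0_cone.2 (hr.mem j))
    have hx : ∑ i : Fin 3, X i.castSucc * lift (pderiv i g) ≠ 0 := by
      rw [sum_X_mul_lift_pderiv hg]
      exact mul_ne_zero (by exact_mod_cast he) (mt lift_eq_zero_iff.1 hg0)
    have hcross := cross_eq_zero (x := fun i : Fin 3 => X i.castSucc)
      (G := fun i => lift (pderiv i g)) ha hu hx hD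
    -- Being parallel to `r j` is a linear system over `ℂ[x, y, z]`.
    have hmem : u ∈ Submodule.span (MvPolynomial (Fin 4) ℂ) {liftVec (r j)} := by
      refine Submodule.span_le.2 ?_ (mem_span_liftVec_of_forall
        (fun (k : Fin 3 × Fin 3) i => (if i = k.1 then r j k.2 else 0) -
          if i = k.2 then r j k.1 else 0) fun k => ?_)
      · rintro _ ⟨v, hv, rfl⟩
        obtain ⟨l, rfl⟩ := hr.exists_eq_smul mem_D0_of_smul_mem j (u := v) fun a b => by
          simpa [mul_sub, Finset.sum_sub_distrib, sub_eq_zero] using hv (a, b)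
        refine Submodule.mem_span_singleton.2 ⟨lift l, ?_⟩
        ext1 i
        simp [liftVec]
      · simpa [mul_sub, Finset.sum_sub_distrib, apply_ite lift, liftVec] using hcross k.1 k.2
    obtain ⟨l, rfl⟩ := Submodule.mem_span_singleton.1 hmem
    rw [Submodule.mem_span_pair]
    exact ⟨h, l, by rw [extend_eq, map_smul]⟩

end Tame

/-! ### Minimal degree, freeness, near freeness and plus-one generation -/

section Main

variable {g : MvPolynomial (Fin 3) ℂ} {e : ℕ}

lemma ne_zero_of_mdr_pos (hg : g.IsHomogeneous e) (hmdr : 0 < mdr g) : e ≠ 0 := by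
  rintro rfl
  refine hmdr.ne' (Nat.sInf_eq_zero.2 (Or.inl ⟨fun _ => 1, ?_, ?_, fun _ => isHomogeneous_one _ _⟩))
  · have hC := HomInt.eq_C (by simpa using homInt_of_isHomogeneous hg)
    rw [mem_D0, hC]
    simp
  · intro h
    exact one_ne_zero (congrFun h 0)

lemma one_le_of_mem_D0 (hmdr : 0 < mdr g) {δ : Fin 3 → MvPolynomial (Fin 3) ℂ} (hδ : δ ∈ D0 g)
    (hδ0 : δ ≠ 0) {k : ℕ} (hk : IsHomogeneousOfDegree δ k) : 1 ≤ k :=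
  hmdr.trans_le (Nat.sInf_le ⟨δ, hδ, hδ0, hk⟩)

lemma mdr_cone (hg : g.IsHomogeneous e) (hg0 : g ≠ 0) (he : e ≠ 0) (hmdr : 0 < mdr g) :
    mdr (cone g) = 1 := by
  have hne : coneEuler e ≠ 0 := fun h => X_ne_zero (R := ℂ) (0 : Fin 4) (congrFun h 0)
  have hmem : 1 ∈ {k | ∃ δ ∈ D0 (cone g), δ ≠ 0 ∧ IsHomogeneousOfDegree δ k} :=
    ⟨_, coneEuler_mem_D0_cone hg, hne, isHomogeneousOfDegree_coneEuler e⟩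
  refine le_antisymm (Nat.sInf_le hmem) (Nat.one_le_iff_ne_zero.2 fun h0 => ?_)
  rcases Nat.sInf_eq_zero.1 h0 with ⟨δ, hδ, hδ0, hk⟩ | hempty
  · -- The entries of `δ` are constants, and the last one is a multiple of `w`.
    have hconst : ∀ i, δ i = C (constantCoeff (δ i)) := fun i =>
      HomInt.eq_C (by simpa using homInt_of_isHomogeneous (hk i))
    obtain ⟨h, u, hu, rfl⟩ := exists_eq_smul_coneEuler_add hg hg0 he hδ
    have h3 : h = 0 := by
      have := hconst 3
      rw [Pi.add_apply, Pi.smul_apply, horizontal_three, coneEuler_three] at this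
      simpa [he] using this
    subst h3
    rw [zero_smul, zero_add] at hδ0 hconst hk
    have hu' : horizontal u = extend fun i => C (constantCoeff (u i)) := by
      rw [extend_eq]
      congr 1
      ext1 i
      have := hconst i.castSucc
      rw [horizontal_castSucc] at this
      rw [liftVec, lift_C]
      exact this
    rw [zero_smul, zero_add, hu', extend_mem_D0_cone] at hδ
    refine absurd (one_le_of_mem_D0 hmdr hδ (fun h => hδ0 ?_) (k := 0)
      fun i => isHomogeneous_C _ _) (by omega)
    rw [hu', h, extend_eq]
    ext1 i
    fin_cases i <;> simp [horizontal, liftVec]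
  · exact Set.notMem_empty 1 (hempty ▸ hmem)

/-- For a minimal family of generators of a graded module, freeness of the module amounts to the
absence of relations. -/
lemma IsMinimalGenerators.free_iff {n m : ℕ}
    {M : Submodule (MvPolynomial (Fin n) ℂ) (Fin n → MvPolynomial (Fin n) ℂ)}
    {r : Fin m → Fin n → MvPolynomial (Fin n) ℂ} (hr : IsMinimalGenerators M r) {d : Fin m → ℕ}
    (hd : ∀ i, IsHomogeneousOfDegree (r i) (d i)) :
    Module.Free (MvPolynomial (Fin n) ℂ) M ↔
      IsMinimalResolution M d (Fin.elim0 : Fin 0 → ℕ) r Fin.elim0 := by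
  constructor
  · intro hfree
    have hlin := Fintype.linearIndependent_iff.1 hr.linearIndependent_of_free
    refine ⟨hd, fun j => j.elim0, hr.span_eq, fun h => ?_, linearIndependent_empty_type,
      fun j => j.elim0⟩
    rw [Set.range_eq_empty, Submodule.span_empty, Submodule.mem_bot]
    refine ⟨fun hs => funext (hlin h hs), ?_⟩
    rintro rfl
    simp
  · intro hres
    have hlin : LinearIndependent (MvPolynomial (Fin n) ℂ) r := by
      rw [Fintype.linearIndependent_iff]
      intro h hs
      have := (hres.exact_rel h).1 hs
      rw [Set.range_eq_empty, Submodule.span_empty, Submodule.mem_bot] at this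
      exact congrFun this
    exact Module.Free.of_basis
      ((Module.Basis.span hlin).map (LinearEquiv.ofEq _ _ hres.span_eq))

lemma exists_isMinimalGenerators_D0 (hg : g.IsHomogeneous e) :
    ∃ (m : ℕ) (r : Fin m → Fin 3 → MvPolynomial (Fin 3) ℂ), IsMinimalGenerators (D0 g) r :=
  exists_isMinimalGenerators fun _ hδ k => compInt_mem_D0 hg hδ k

lemma isFree_cone_iff (hg : g.IsHomogeneous e) (hg0 : g ≠ 0) (he : e ≠ 0) :
    IsFree (cone g) ↔ IsFree g := by
  obtain ⟨m, r, hr⟩ := exists_isMinimalGenerators_D0 hg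
  choose d hd using hr.homogeneous
  have hd' : ∀ i, IsHomogeneousOfDegree (coneFamily e r i) ((Fin.cons 1 d : Fin (m + 1) → ℕ) i) :=
    Fin.cases (isHomogeneousOfDegree_coneEuler e)
      fun i => isHomogeneousOfDegree_extend_iff.2 (hd i)
  rw [IsFree, IsFree, hr.free_iff hd, (hr.coneFamily hg hg0 he).free_iff hd']
  constructor
  · intro h
    convert h.of_coneFamily he using 1
    rfl
  · intro h
    convert h.coneFamily hg hg0 he using 1

lemma vec_one_cons_zero {p : ℕ} (a : Fin p → MvPolynomial (Fin 3) ℂ) :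
    (fun j => Fin.cons 0 fun i => lift ((![a] : Fin 1 → _) j i) :
      Fin 1 → Fin (p + 1) → MvPolynomial (Fin 4) ℂ) = ![Fin.cons 0 fun i => lift (a i)] := by
  ext1 j
  rw [Subsingleton.elim j 0]
  rfl

lemma vec_one_restrict {p : ℕ} (a : Fin (p + 1) → MvPolynomial (Fin 4) ℂ) :
    (fun j i => restrict ((![a] : Fin 1 → _) j (Fin.succ i)) :
      Fin 1 → Fin p → MvPolynomial (Fin 3) ℂ) = ![fun i => restrict (a i.succ)] := by
  ext1 j
  rw [Subsingleton.elim j 0]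
  rfl

lemma isNearlyFree_cone_of_isNearlyFree (hg : g.IsHomogeneous e) (hg0 : g ≠ 0) (he : e ≠ 0)
    (hmdr : 0 < mdr g) (h : IsNearlyFree (n := 1) g) : IsNearlyFree (n := 2) (cone g) := by
  obtain ⟨d, r, a, hmono, hd, hres⟩ := h
  have hmin := hres.isMinimalGenerators
  refine ⟨Fin.cons 1 d, coneFamily e r, Fin.cons 0 fun i => lift (a i), ?_, hd, ?_⟩
  · have h1 : ∀ i, 1 ≤ d i := fun i =>
      one_le_of_mem_D0 hmdr (hmin.mem i) (hmin.ne_zero i) (hres.homogeneous_gen i)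
    intro i j hij
    induction i using Fin.cases with
    | zero => induction j using Fin.cases with
      | zero => exact le_rfl
      | succ j => exact h1 j
    | succ i => induction j using Fin.cases with
      | zero => exact absurd hij (by simp)
      | succ j => exact hmono (Fin.succ_le_succ_iff.1 hij)
  · rw [← vec_one_cons_zero]
    exact hres.coneFamily hg hg0 he

lemma isNearlyFree_of_isNearlyFree_cone (hg : g.IsHomogeneous e) (hg0 : g ≠ 0) (he : e ≠ 0)
    (hmdr : 0 < mdr g) (h : IsNearlyFree (n := 2) (cone g)) : IsNearlyFree (n := 1) g := by
  obtain ⟨d, ρ, a, hmono, hd, hres⟩ := h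
  obtain ⟨m, r, hr⟩ := exists_isMinimalGenerators_D0 hg
  obtain ⟨σ, hσ⟩ := hres.isMinimalGenerators.exists_equiv hres.homogeneous_gen
    (hr.coneFamily hg hg0 he)
  obtain rfl : m = 3 := by
    have := Fintype.card_congr σ
    simp only [Fintype.card_fin] at this
    omega
  have hdeg : ∀ (i : Fin 4) (k : ℕ), IsHomogeneousOfDegree (coneFamily e r i) k →
      1 ≤ k ∧ (i = 0 → k = 1) := by
    intro i k hk
    induction i using Fin.cases with
    | zero =>
      have := (hk 0).inj_right (isHomogeneousOfDegree_coneEuler e 0)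
        (X_ne_zero (R := ℂ) (0 : Fin 4))
      omega
    | succ i =>
      exact ⟨one_le_of_mem_D0 hmdr (hr.mem i) (hr.ne_zero i)
        (isHomogeneousOfDegree_extend_iff.1 hk), fun h => absurd h (Fin.succ_ne_zero i)⟩
  -- The smallest degree is that of the Euler-type derivation, which may be numbered first.
  have hd0 : d (σ.symm 0) = d 0 := by
    have h1 := (hdeg _ _ (hσ (σ.symm 0))).2 (σ.apply_symm_apply 0)
    have h2 := (hdeg _ _ (hσ 0)).1
    have h3 := hmono (Fin.zero_le (σ.symm 0))
    omega
  let τ : Equiv.Perm (Fin 4) := (Equiv.swap 0 (σ.symm 0)).trans σ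
  have hτ0 : τ 0 = 0 := by simp [τ]
  have hτ : ∀ j, IsHomogeneousOfDegree (coneFamily e r (τ j)) (d j) := by
    intro j
    have := hσ (Equiv.swap 0 (σ.symm 0) j)
    have hdj : d (Equiv.swap 0 (σ.symm 0) j) = d j := by
      by_cases h0 : j = 0
      · rw [h0, Equiv.swap_apply_left, hd0]
      by_cases h1 : j = σ.symm 0
      · rw [h1, Equiv.swap_apply_right, hd0]
      · rw [Equiv.swap_apply_of_ne_of_ne h0 h1]
    rwa [hdj] at this
  obtain ⟨π, hπ⟩ : ∃ π : Equiv.Perm (Fin 3), ∀ i, τ i.succ = (π i).succ := by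
    have hne : ∀ i : Fin 3, τ i.succ ≠ 0 := fun i h =>
      Fin.succ_ne_zero i (τ.injective (h.trans hτ0.symm))
    have hinj : Function.Injective fun i : Fin 3 => (τ i.succ).pred (hne i) := fun i j hij =>
      Fin.succ_injective _ (τ.injective (Fin.pred_inj.1 hij))
    exact ⟨Equiv.ofBijective _ (Finite.injective_iff_bijective.1 hinj),
      fun i => (Fin.succ_pred _ (hne i)).symm⟩
  have hr' := hr.comp_equiv π
  have hd' : ∀ j, IsHomogeneousOfDegree (coneFamily e (r ∘ π) j) (d j) := by
    intro j
    induction j using Fin.cases with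
    | zero =>
      have := hτ 0
      rwa [hτ0] at this
    | succ j =>
      have := hτ j.succ
      rwa [hπ] at this
  obtain ⟨A, hA⟩ := hres.exists_of_isMinimalGenerators (hr'.coneFamily hg hg0 he) hd'
  refine ⟨fun i => d i.succ, r ∘ π, fun i => restrict (A 0 i.succ),
    fun i j hij => hmono (Fin.succ_le_succ_iff.2 hij), hd, ?_⟩
  have hA0 : A = ![A 0] := by
    ext1 j
    rw [Subsingleton.elim j 0]
    rfl
  rw [hA0] at hA
  rw [← vec_one_restrict]
  exact hA.of_coneFamily he

/-- In a plane curve's plus-one generated resolution the last coefficient of the relation does not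
vanish: otherwise the first two generators are proportional, hence redundant. -/
lemma last_relation_coeff_ne_zero {d : Fin 3 → ℕ} {c : Fin 1 → ℕ}
    {r : Fin 3 → Fin 3 → MvPolynomial (Fin 3) ℂ} {a : Fin 3 → MvPolynomial (Fin 3) ℂ}
    (hres : IsMinimalResolution (D0 g) d c r ![a]) : a 2 ≠ 0 := by
  intro h2
  have hmin := hres.isMinimalGenerators
  have hrel := hres.sum_smul_rel 0
  simp only [Matrix.cons_val_zero, Fin.sum_univ_three, h2, zero_smul, add_zero] at hrel
  have ha1 : a 1 ≠ 0 := by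
    intro h1
    rw [h1, zero_smul, add_zero] at hrel
    have h0 := (smul_eq_zero.1 hrel).resolve_right (hmin.ne_zero 0)
    refine hres.injective_rel.ne_zero 0 ?_
    ext1 i
    fin_cases i
    exacts [h0, h1, h2]
  obtain ⟨h, hh⟩ := hmin.exists_eq_smul mem_D0_of_smul_mem 0 (u := r 1) fun i j => by
    have hi := congrFun hrel i
    have hj := congrFun hrel j
    simp only [Pi.add_apply, Pi.smul_apply, smul_eq_mul, Pi.zero_apply] at hi hj
    refine mul_left_cancel₀ ha1 ?_
    linear_combination r 0 j * hi - r 0 i * hj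
  refine hmin.irredundant 1 ?_
  rw [hh]
  exact Submodule.smul_mem _ _ (Submodule.subset_span ⟨0, by simp, rfl⟩)

lemma isStrictlyPlusOneGenerated_cone_iff (hg : g.IsHomogeneous e) (hg0 : g ≠ 0) (he : e ≠ 0)
    (r : Fin 3 → Fin 3 → MvPolynomial (Fin 3) ℂ) :
    IsStrictlyPlusOneGenerated (n := 3) (cone g) (coneFamily e r) ↔
      IsPlusOneGenerated (n := 2) g r := by
  constructor
  · rintro ⟨d, a, hres, -⟩
    refine ⟨fun i => d i.succ, fun i => restrict (a i.succ), ?_⟩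
    rw [← vec_one_restrict]
    exact hres.of_coneFamily he
  · rintro ⟨d, a, hres⟩
    refine ⟨Fin.cons 1 d, Fin.cons 0 fun i => lift (a i), ?_, ?_⟩
    · rw [← vec_one_cons_zero]
      exact hres.coneFamily hg hg0 he
    · exact mt lift_eq_zero_iff.1 (last_relation_coeff_ne_zero hres)

end Main

end JacobianSyzygies

end

open JacobianSyzygies in
theorem theorem1p6 (g : MvPolynomial (Fin 3) ℂ) (e : ℕ) (hhom : g.IsHomogeneous e)
    (hred : Squarefree g) (hmdr : 0 < mdr g) :
    -- (1) generators, minimal degree, minimal resolution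
    (∀ (m : ℕ) (r : Fin m → Fin 3 → MvPolynomial (Fin 3) ℂ),
      IsMinimalGenerators (D0 g) r → IsMinimalGenerators (D0 (cone g)) (coneFamily e r)) ∧
    mdr (cone g) = 1 ∧
    (∀ (p q : ℕ) (d : Fin p → ℕ) (c : Fin q → ℕ) (r : Fin p → Fin 3 → MvPolynomial (Fin 3) ℂ)
      (A : Fin q → Fin p → MvPolynomial (Fin 3) ℂ),
      IsMinimalResolution (D0 g) d c r A →
      IsMinimalResolution (D0 (cone g)) (Fin.cons 1 d : Fin (p + 1) → ℕ) c (coneFamily e r)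
        (fun j => Fin.cons 0 fun i => lift (A j i))) ∧
    -- (2) tameness
    (∀ (m : ℕ) (r : Fin m → Fin 3 → MvPolynomial (Fin 3) ℂ),
      IsMinimalGenerators (D0 g) r → ∀ j, IsTame (cone g) (coneEuler e) (extend (r j))) ∧
    -- (3) freeness, near freeness, plus-one generation
    (IsFree (cone g) ↔ IsFree g) ∧
    (IsNearlyFree (n := 2) (cone g) ↔ IsNearlyFree (n := 1) g) ∧
    (∀ r : Fin 3 → Fin 3 → MvPolynomial (Fin 3) ℂ,
      IsStrictlyPlusOneGenerated (n := 3) (cone g) (coneFamily e r) ↔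
        IsPlusOneGenerated (n := 2) g r) := by
  have hg0 : g ≠ 0 := hred.ne_zero
  have he : e ≠ 0 := ne_zero_of_mdr_pos hhom hmdr
  exact ⟨fun m r hr => hr.coneFamily hhom hg0 he, mdr_cone hhom hg0 he hmdr,
    fun p q d c r A hr => hr.coneFamily hhom hg0 he,
    fun m r hr j => hr.isTame hhom hg0 he j,
    isFree_cone_iff hhom hg0 he,
    ⟨isNearlyFree_of_isNearlyFree_cone hhom hg0 he hmdr,
      isNearlyFree_cone_of_isNearlyFree hhom hg0 he hmdr⟩,
    isStrictlyPlusOneGenerated_cone_iff hhom hg0 he⟩
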